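/- Let $s\in(0,1)$ and $s+1<p<\frac{s}{1-s}$, let $\Omega\subset\mathbb{R}^N$ be a bounded open set (in particular, a bounded domain with $C^2$ boundary), and let $T>0$. For $A\subset\mathbb{R}^N$ write $$I[A](\psi)(x)=C_{N,s}\,\mathrm{P.V.}\!\int_A\frac{\psi(x)-\psi(y)}{|x-y|^{N+2s}}\,dy,\qquad (-\Delta)^s\psi=I[\mathbb{R}^N](\psi),\qquad C_{N,s}=\frac{s\,4^s\,\Gamma(\frac N2+s)}{\pi^{N/2}\,\Gamma(1-s)}.$$ For $u:\overline\Omega\times[0,T]\to\mathbb{R}$ let $\tilde u:\mathbb{R}^N\times[0,T]\to\mathbb{R}$ be its lower $0$-extension: $\tilde u=u$ in $\Omega\times[0,T]$, $\tilde u=\min\{u,0\}$ on $\partial\Omega\times[0,T]$, and $\tilde u=0$ on $(\mathbb{R}^N\setminus\overline\Omega)\times[0,T]$. A bounded lower semicontinuous $u$ is a (viscosity) supersolution of $$u_t+(-\Delta)^su=|Du|^p\quad\text{in }\Omega\times(0,T)$$ if, whenever $(x,t)\in\Omega\times(0,T)$, $\rho>0$ with $(t-\rho,t+\rho)\subset(0,T)$,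 $\phi\in C^2(B_\rho(x)\times(t-\rho,t+\rho))$, and $\tilde u-\phi$ has a minimum over $B_\rho(x)\times(t-\rho,t+\rho)$ at $(x,t)$, one has for every $0<r<\rho$ $$\phi_t(x,t)+I[B_r(x)](\phi(\cdot,t))(x)+I[\mathbb{R}^N\setminus B_r(x)](\tilde u(\cdot,t))(x)-|D\phi(x,t)|^p\ge 0.$$ For $\epsilon,\delta,\kappa>0$ set $$\tilde u_{\epsilon,\kappa}(x,t)=\inf_{(y,\tau)\in\mathbb{R}^N\times(0,T)}\Big(\tilde u(y,\tau)+\tfrac{1}{2\epsilon}|x-y|^2+\tfrac1{2\kappa}|t-\tau|^2\Big),\qquad v^\delta(x,t)=\sup_{y\in\mathbb{R}^N}\Big(v(y,t)-\tfrac1{2\delta}|x-y|^2\Big),$$ and, for $\eta>0$, $\Omega^\eta=\{x\in\Omega:\mathrm{dist}(x,\partial\Omega)>\eta\}$. **Proposition.** Let $\eta>0$, $0<t_0<t_1<T$, and let $u:\overline\Omega\times[0,T]\to\mathbb{R}$ be a bounded, lower semicontinuous supersolution of the equation in $\Omega\times(0,T)$. Then there exist $\epsilon,\delta,\kappa>0$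 such that $w=(\tilde u_{\epsilon+\delta,\kappa})^\delta$ satisfies $$w_t+(-\Delta)^sw-|Dw|^p\ge 0\quad\text{a.e. in }\Omega^\eta\times(t_0,t_1);$$ that is, at almost every point $(x,t)$ of this set the derivatives $w_t(x,t)$, $Dw(x,t)$ and the principal value $(-\Delta)^sw(x,t)$ exist (the truncated integrals converging absolutely), and the inequality holds there. -/

import Mathlib

open Set Filter Topology MeasureTheory

namespace FracHJ

noncomputable section

/-- The normalization constant `C_{N,s}` of the fractional Laplacian,
`C_{N,s} = s 4^s Γ(N/2 + s) / (π^(N/2) Γ(1 - s))`. -/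
def normConst (N : ℕ) (s : ℝ) : ℝ :=
  s * (4 : ℝ) ^ s * Real.Gamma ((N : ℝ) / 2 + s) /
    (Real.pi ^ ((N : ℝ) / 2) * Real.Gamma (1 - s))

/-- The integrand `(ψ(x) - ψ(y)) / |x - y|^(N + 2s)`. -/
def kernelDiff {N : ℕ} (s : ℝ) (ψ : EuclideanSpace ℝ (Fin N) → ℝ)
    (x y : EuclideanSpace ℝ (Fin N)) : ℝ :=
  (ψ x - ψ y) / ‖x - y‖ ^ ((N : ℝ) + 2 * s)

/-- `HasNonlocal s A ψ x L`: the principal value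
`I[A](ψ)(x) = C_{N,s} P.V. ∫_A (ψ(x) - ψ(y)) / |x - y|^(N + 2s) dy` exists and equals `L`, i.e. the
integrals over `A \ B_ω(x)` converge absolutely and tend to `L` as `ω → 0⁺`. -/
def HasNonlocal {N : ℕ} (s : ℝ) (A : Set (EuclideanSpace ℝ (Fin N)))
    (ψ : EuclideanSpace ℝ (Fin N) → ℝ) (x : EuclideanSpace ℝ (Fin N)) (L : ℝ) : Prop :=
  (∀ ω : ℝ, 0 < ω → IntegrableOn (kernelDiff s ψ x) (A \ Metric.ball x ω)) ∧
    Tendsto (fun ω : ℝ => normConst N s * ∫ y in A \ Metric.ball x ω, kernelDiff s ψ x y)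
      (𝓝[>] 0) (𝓝 L)

/-- `(-Δ)^s ψ (x)` exists (as a principal value) and equals `L`. -/
def HasFracLaplacian {N : ℕ} (s : ℝ) (ψ : EuclideanSpace ℝ (Fin N) → ℝ)
    (x : EuclideanSpace ℝ (Fin N)) (L : ℝ) : Prop :=
  HasNonlocal s univ ψ x L

open Classical in
/-- The lower `0`-extension `ũ` of `u`: equal to `u` in `Ω`, to `min {u, 0}` on `∂Ω`, and to `0`
outside the closure of `Ω`. -/
def lowerExt {N : ℕ} (Ω : Set (EuclideanSpace ℝ (Fin N)))
    (u : EuclideanSpace ℝ (Fin N) → ℝ → ℝ) (x : EuclideanSpace ℝ (Fin N)) (t : ℝ) : ℝ :=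
  if x ∈ Ω then u x t else if x ∈ frontier Ω then min (u x t) 0 else 0

/-- `u` is a viscosity supersolution of `u_t + (-Δ)^s u = |Du|^p` in `Ω × (0,T)` (with the exterior
datum `0`, through the extension `ũ`). Whenever `φ` is `C²` on the cylinder
`B_δ(x) × (t-δ, t+δ)` and `ũ - φ` has a minimum over this cylinder at its centre `(x,t)`, then
`E_r(ũ, φ, x, t) = φ_t + I[B_r(x)](φ) + I[ℝ^N \ B_r(x)](ũ) - |Dφ|^p ≥ 0`.
The radius `r` runs over `(0, δ)`, so that `φ` is bounded on `B_r(x)`; both nonlocal terms `a`, `b`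
then have a (unique) value when `ũ` is bounded and measurable, and the inequality for a smaller
radius implies it for a larger one. -/
def IsSupersolution {N : ℕ} (s p : ℝ) (Ω : Set (EuclideanSpace ℝ (Fin N))) (T : ℝ)
    (u : EuclideanSpace ℝ (Fin N) → ℝ → ℝ) : Prop :=
  ∀ x ∈ Ω, ∀ t δ : ℝ, 0 < δ → 0 ≤ t - δ → t + δ ≤ T →
    ∀ φ : EuclideanSpace ℝ (Fin N) → ℝ → ℝ,
      ContDiffOn ℝ 2 (fun z : EuclideanSpace ℝ (Fin N) × ℝ => φ z.1 z.2)
        (Metric.ball x δ ×ˢ Ioo (t - δ) (t + δ)) →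
      (∀ y ∈ Metric.ball x δ, ∀ τ ∈ Ioo (t - δ) (t + δ),
        lowerExt Ω u x t - φ x t ≤ lowerExt Ω u y τ - φ y τ) →
      ∀ r : ℝ, 0 < r → r < δ → ∀ a b : ℝ,
        HasNonlocal s (Metric.ball x r) (fun y => φ y t) x a →
        HasNonlocal s (Metric.ball x r)ᶜ (fun y => lowerExt Ω u y t) x b →
        0 ≤ deriv (fun τ => φ x τ) t + a + b - ‖gradient (fun y => φ y t) x‖ ^ p

/-- Inf-convolution in space and time of a function on `ℝ^N × (0,T)`:
`v_{ε,κ}(x,t) = inf_{(y,τ) ∈ ℝ^N × (0,T)} (v(y,τ) + |x-y|²/(2ε) + |t-τ|²/(2κ))`. -/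
def infConv {N : ℕ} (T ε κ : ℝ) (v : EuclideanSpace ℝ (Fin N) → ℝ → ℝ)
    (x : EuclideanSpace ℝ (Fin N)) (t : ℝ) : ℝ :=
  ⨅ z : EuclideanSpace ℝ (Fin N) × Ioo (0 : ℝ) T,
    (v z.1 z.2 + 1 / (2 * ε) * ‖x - z.1‖ ^ 2 + 1 / (2 * κ) * |t - z.2| ^ 2)

/-- Sup-convolution in space only: `v^δ(x,t) = sup_{y ∈ ℝ^N} (v(y,t) - |x-y|²/(2δ))`. -/
def supConv {N : ℕ} (δ : ℝ) (v : EuclideanSpace ℝ (Fin N) → ℝ → ℝ)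
    (x : EuclideanSpace ℝ (Fin N)) (t : ℝ) : ℝ :=
  ⨆ y : EuclideanSpace ℝ (Fin N), (v y t - 1 / (2 * δ) * ‖x - y‖ ^ 2)

/-- The inf-sup-convolution `w = (ũ_{ε+δ,κ})^δ`. -/
def infSupConv {N : ℕ} (Ω : Set (EuclideanSpace ℝ (Fin N))) (T ε δ κ : ℝ)
    (u : EuclideanSpace ℝ (Fin N) → ℝ → ℝ) : EuclideanSpace ℝ (Fin N) → ℝ → ℝ :=
  supConv δ (infConv T (ε + δ) κ (lowerExt Ω u))

/-- `Ω^η = {x ∈ Ω : dist(x, ∂Ω) > η}`. -/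
def innerSet {N : ℕ} (Ω : Set (EuclideanSpace ℝ (Fin N))) (η : ℝ) :
    Set (EuclideanSpace ℝ (Fin N)) :=
  {x ∈ Ω | η < Metric.infDist x (frontier Ω)}

end

end FracHJ

/-!
Write `v = ũ`, `V = ũ_{ε+δ,κ}` and `w = V^δ`. The proof transfers the viscosity inequality from `ũ`
to `w` by convex averaging, without second-order differentiability results.

Let `w(x,t) = V(y,t) - |x-y|²/(2δ)`. Since `V(·,t)` is an infimum of paraboloids, maximality of `y`
and Danskin's theorem (`smul_sub_mem_convexHull_of_isMax`) write the gradient `q = (y-x)/δ` of `w`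
at `x` as an average `∑ μᵢ (y-zᵢ)/(ε+δ)` over points `(zᵢ,τᵢ)` where the infimum `V(y,t)` is
attained (`exists_isDecomposition`). Inserting `(zᵢ+a,τᵢ)` as competitors in the infimum for a
nearby point and averaging, the linear terms cancel, and one gets
(`IsDecomposition.supConv_add_le`)

* `w(x+h,t) - w(x,t) ≤ ∑ μᵢ (ũ(zᵢ+h,τᵢ) - ũ(zᵢ,τᵢ))` for all `h`, so the nonlocal term of `w` at
  `x` dominates the average of those of `ũ` at `(zᵢ,τᵢ)`;
* `w(x,·)` is touched from above by an average of parabolas, so `w_t(x,t) = ∑ μᵢ (t-τᵢ)/κ` wherever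
  `w_t` exists, which is almost everywhere because `w` is Lipschitz;
* `w(·,t)` lies between two parabolas touching at `x`, so `Dw` and the principal value exist at
  every `x`.

At `(zᵢ,τᵢ)` the paraboloid centred at `(y,t)` touches `ũ` from below. For small parameters `zᵢ`
lies in `Ω`, so this is an admissible test function, with time derivative `(t-τᵢ)/κ` and gradient
`(y-zᵢ)/(ε+δ)`; as the radius of the test ball tends to `0` it drops out of the nonlocal term
(`IsSupersolution.exists_tendsto_of_mem_infArgmin`). Averaging these inequalities, with Jensen's
inequality `|q|^p ≤ ∑ μᵢ |(y-zᵢ)/(ε+δ)|^p`, gives the inequality for `w`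
(`IsDecomposition.add_sub_rpow_nonneg`).
-/

namespace FracHJ

open scoped RealInnerProductSpace

/-! ### Convex hulls of compact sets -/

/-- In finite dimension the convex hull of a compact set is compact. -/
theorem isCompact_convexHull {E : Type*} [NormedAddCommGroup E] [NormedSpace ℝ E]
    [FiniteDimensional ℝ E] {s : Set E} (hs : IsCompact s) : IsCompact (convexHull ℝ s) := by
  rcases s.eq_empty_or_nonempty with rfl | ⟨a, ha⟩
  · simp
  set n := Module.finrank ℝ E + 1 with hn
  -- Carathéodory: `n` points suffice, so the hull is a continuous image of `simplex × sⁿ`.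
  have key : convexHull ℝ s = (fun q : (Fin n → ℝ) × (Fin n → E) => ∑ i, q.1 i • q.2 i) ''
      (stdSimplex ℝ (Fin n) ×ˢ Set.pi univ fun _ => s) := by
    ext y
    constructor
    · intro hy
      obtain ⟨ι, _, z, w, hz, hind, hw, hw1, rfl⟩ := eq_pos_convex_span_of_mem_convexHull hy
      have hcard : Fintype.card ι ≤ n :=
        hind.card_le_finrank_succ.trans (Nat.succ_le_succ (Submodule.finrank_le _))
      obtain ⟨e⟩ : Nonempty (ι ↪ Fin n) := Function.Embedding.nonempty_of_card_le (by simpa)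
      refine ⟨(Function.extend e w 0, Function.extend e z fun _ => a), ⟨⟨fun j => ?_, ?_⟩, ?_⟩, ?_⟩
      · by_cases hj : ∃ i, e i = j
        · obtain ⟨i, rfl⟩ := hj
          simpa [e.injective.extend_apply] using (hw i).le
        · simp [Function.extend_apply' _ _ _ hj]
      · rw [← hw1]
        refine (Fintype.sum_of_injective e e.injective _ _ (fun j hj => ?_) fun i => ?_).symm
        · exact Function.extend_apply' _ _ _ hj
        · exact (e.injective.extend_apply _ _ _).symm
      · intro j _
        by_cases hj : ∃ i, e i = j
        · obtain ⟨i, rfl⟩ := hj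
          simpa [e.injective.extend_apply] using hz (mem_range_self i)
        · simpa [Function.extend_apply' _ _ _ hj] using ha
      · refine (Fintype.sum_of_injective e e.injective _ _ (fun j hj => ?_) fun i => ?_).symm
        · simp [Function.extend_apply' w _ _ hj]
        · simp [e.injective.extend_apply]
    · rintro ⟨⟨w, z⟩, ⟨hw, hz⟩, rfl⟩
      exact (convex_convexHull ℝ s).sum_mem (fun i _ => hw.1 i) hw.2
        fun i _ => subset_convexHull ℝ s (hz i (mem_univ i))
  rw [key]
  refine ((isCompact_stdSimplex ℝ (Fin n)).prod (isCompact_univ_pi fun _ => hs)).image ?_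
  fun_prop

/-! ### The inf-convolution -/

/-- `v` is bounded by `M` and lower semicontinuous on `ℝ^N × [0,T]`. Nothing is required for times
outside `[0,T]`, which the inf-convolution does not see. -/
structure IsBddLsc {N : ℕ} (T M : ℝ) (v : EuclideanSpace ℝ (Fin N) → ℝ → ℝ) : Prop where
  bound : ∀ z, ∀ τ ∈ Icc 0 T, |v z τ| ≤ M
  lsc : LowerSemicontinuousOn (fun z : EuclideanSpace ℝ (Fin N) × ℝ => v z.1 z.2)
    (univ ×ˢ Icc 0 T)

/-- The function of `z = (y,τ)` whose infimum over `ℝ^N × (0,T)` is `infConv T ε κ v x t`. -/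
noncomputable def infCost {N : ℕ} (ε κ : ℝ) (v : EuclideanSpace ℝ (Fin N) → ℝ → ℝ)
    (x : EuclideanSpace ℝ (Fin N)) (t : ℝ) (z : EuclideanSpace ℝ (Fin N) × ℝ) : ℝ :=
  v z.1 z.2 + 1 / (2 * ε) * ‖x - z.1‖ ^ 2 + 1 / (2 * κ) * |t - z.2| ^ 2

/-- The points of `ℝ^N × (0,T)` at which the infimum defining `infConv T ε κ v x t` is attained. -/
def infArgmin {N : ℕ} (T ε κ : ℝ) (v : EuclideanSpace ℝ (Fin N) → ℝ → ℝ)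
    (x : EuclideanSpace ℝ (Fin N)) (t : ℝ) : Set (EuclideanSpace ℝ (Fin N) × ℝ) :=
  {z | z.2 ∈ Ioo 0 T ∧ ∀ y : EuclideanSpace ℝ (Fin N) × ℝ, y.2 ∈ Ioo 0 T →
    infCost ε κ v x t z ≤ infCost ε κ v x t y}

section infConv

variable {N : ℕ} {T M ε κ t : ℝ} {v : EuclideanSpace ℝ (Fin N) → ℝ → ℝ}
  {x : EuclideanSpace ℝ (Fin N)}

theorem neg_le_infCost (hv : IsBddLsc T M v) (hε : 0 < ε) (hκ : 0 < κ)
    {y : EuclideanSpace ℝ (Fin N) × ℝ} (hy : y.2 ∈ Ioo 0 T) : -M ≤ infCost ε κ v x t y := by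
  have h1 := (abs_le.1 (hv.bound y.1 y.2 (Ioo_subset_Icc_self hy))).1
  have h2 : 0 ≤ 1 / (2 * ε) * ‖x - y.1‖ ^ 2 := by positivity
  have h3 : 0 ≤ 1 / (2 * κ) * |t - y.2| ^ 2 := by positivity
  unfold infCost
  linarith

theorem bddBelow_infCost (hv : IsBddLsc T M v) (hε : 0 < ε) (hκ : 0 < κ) :
    BddBelow (range fun z : EuclideanSpace ℝ (Fin N) × Ioo (0 : ℝ) T =>
      v z.1 z.2 + 1 / (2 * ε) * ‖x - z.1‖ ^ 2 + 1 / (2 * κ) * |t - z.2| ^ 2) := by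
  refine ⟨-M, ?_⟩
  rintro _ ⟨z, rfl⟩
  exact neg_le_infCost hv hε hκ (y := (z.1, z.2)) z.2.2

theorem infConv_le (hv : IsBddLsc T M v) (hε : 0 < ε) (hκ : 0 < κ)
    {y : EuclideanSpace ℝ (Fin N) × ℝ} (hy : y.2 ∈ Ioo 0 T) :
    infConv T ε κ v x t ≤ infCost ε κ v x t y :=
  ciInf_le (bddBelow_infCost hv hε hκ)
    ((y.1, ⟨y.2, hy⟩) : EuclideanSpace ℝ (Fin N) × Ioo (0 : ℝ) T)

theorem le_infConv (hT : 0 < T) {a : ℝ}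
    (h : ∀ y : EuclideanSpace ℝ (Fin N) × ℝ, y.2 ∈ Ioo 0 T → a ≤ infCost ε κ v x t y) :
    a ≤ infConv T ε κ v x t := by
  have : Nonempty (Ioo (0 : ℝ) T) := ⟨⟨T / 2, by constructor <;> linarith⟩⟩
  exact le_ciInf fun z => h (z.1, z.2) z.2.2

theorem infConv_eq_infCost (hv : IsBddLsc T M v) (hε : 0 < ε) (hκ : 0 < κ)
    {z : EuclideanSpace ℝ (Fin N) × ℝ} (hz : z ∈ infArgmin T ε κ v x t) :
    infConv T ε κ v x t = infCost ε κ v x t z :=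
  le_antisymm (infConv_le hv hε hκ hz.1) (le_infConv (hz.1.1.trans hz.1.2) hz.2)

theorem infCost_self : infCost ε κ v x t (x, t) = v x t := by simp [infCost]

theorem abs_infConv_le (hv : IsBddLsc T M v) (hε : 0 < ε) (hκ : 0 < κ) (ht : t ∈ Ioo 0 T) :
    |infConv T ε κ v x t| ≤ M := by
  refine abs_le.2 ⟨le_infConv (ht.1.trans ht.2) fun y hy => neg_le_infCost hv hε hκ hy, ?_⟩
  refine (infConv_le hv hε hκ (y := (x, t)) ht).trans ?_
  rw [infCost_self]
  exact (abs_le.1 (hv.bound x t (Ioo_subset_Icc_self ht))).2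

/-- Points at least as good as the centre `(x,t)` are `O(√ε)`-close in space, `O(√κ)` in time. -/
theorem quad_le_of_infCost_le (hv : IsBddLsc T M v) (hε : 0 < ε) (hκ : 0 < κ)
    (ht : t ∈ Ioo 0 T) {z : EuclideanSpace ℝ (Fin N) × ℝ} (hz2 : z.2 ∈ Ioo 0 T)
    (hz : infCost ε κ v x t z ≤ infCost ε κ v x t (x, t)) :
    ‖x - z.1‖ ^ 2 ≤ 4 * M * ε ∧ |t - z.2| ^ 2 ≤ 4 * M * κ := by
  have h1 := (abs_le.1 (hv.bound z.1 z.2 (Ioo_subset_Icc_self hz2))).1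
  have h4 := (abs_le.1 (hv.bound x t (Ioo_subset_Icc_self ht))).2
  have h2 : 0 ≤ 1 / (2 * ε) * ‖x - z.1‖ ^ 2 := by positivity
  have h3 : 0 ≤ 1 / (2 * κ) * |t - z.2| ^ 2 := by positivity
  rw [infCost_self] at hz
  unfold infCost at hz
  have h5 : 1 / (2 * ε) * ‖x - z.1‖ ^ 2 ≤ 2 * M := by linarith
  have h6 : 1 / (2 * κ) * |t - z.2| ^ 2 ≤ 2 * M := by linarith
  rw [div_mul_eq_mul_div, one_mul, div_le_iff₀ (by positivity)] at h5 h6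
  constructor <;> linarith

theorem quad_le_of_mem_infArgmin (hv : IsBddLsc T M v) (hε : 0 < ε) (hκ : 0 < κ)
    (ht : t ∈ Ioo 0 T) {z : EuclideanSpace ℝ (Fin N) × ℝ} (hz : z ∈ infArgmin T ε κ v x t) :
    ‖x - z.1‖ ^ 2 ≤ 4 * M * ε ∧ |t - z.2| ^ 2 ≤ 4 * M * κ :=
  quad_le_of_infCost_le hv hε hκ ht hz.1 (hz.2 _ ht)

/-- Although `ℝ^N × (0,T)` is neither closed nor bounded, the infimum is attained when `t` keeps a
distance `ρ ≥ √(4Mκ)` from `0` and `T`: better points than `(x,t)` lie in a compact cylinder. -/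
theorem infArgmin_nonempty (hv : IsBddLsc T M v) (hε : 0 < ε) (hκ : 0 < κ) {ρ : ℝ} (hρ : 0 ≤ ρ)
    (hρt : ρ < t) (hρT : t + ρ < T) (hMρ : 4 * M * κ ≤ ρ ^ 2) :
    (infArgmin T ε κ v x t).Nonempty := by
  have ht : t ∈ Ioo 0 T := ⟨by linarith, by linarith⟩
  set K : Set (EuclideanSpace ℝ (Fin N) × ℝ) :=
    Metric.closedBall x (√(4 * M * ε)) ×ˢ Icc (t - ρ) (t + ρ) with hK
  have hKT : ∀ z ∈ K, z.2 ∈ Ioo 0 T := fun z hz =>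
    ⟨by linarith [hz.2.1], by linarith [hz.2.2]⟩
  have hxK : (x, t) ∈ K :=
    ⟨Metric.mem_closedBall_self (Real.sqrt_nonneg _), ⟨by simpa, by simpa⟩⟩
  have hlsc : LowerSemicontinuousOn (infCost ε κ v x t) K := by
    have hsub : K ⊆ univ ×ˢ Icc 0 T := fun z hz => ⟨mem_univ _, Ioo_subset_Icc_self (hKT z hz)⟩
    have h1 := hv.lsc.mono hsub
    have h2 : Continuous fun z : EuclideanSpace ℝ (Fin N) × ℝ =>
        1 / (2 * ε) * ‖x - z.1‖ ^ 2 + 1 / (2 * κ) * |t - z.2| ^ 2 := by fun_prop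
    have h3 : infCost ε κ v x t = fun z => v z.1 z.2 +
        (1 / (2 * ε) * ‖x - z.1‖ ^ 2 + 1 / (2 * κ) * |t - z.2| ^ 2) := by
      funext z
      simp only [infCost, add_assoc]
    rw [h3]
    exact h1.add (h2.continuousOn (s := K)).lowerSemicontinuousOn
  obtain ⟨z, hzK, hz⟩ := hlsc.exists_isMinOn ⟨_, hxK⟩
    ((isCompact_closedBall _ _).prod isCompact_Icc)
  refine ⟨z, hKT z hzK, fun y hy => ?_⟩
  by_cases hyK : y ∈ K
  · exact hz hyK
  · by_contra! hlt
    apply hyK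
    obtain ⟨h1, h2⟩ := quad_le_of_infCost_le hv hε hκ ht hy (hlt.le.trans (hz hxK))
    refine ⟨?_, ?_⟩
    · rw [Metric.mem_closedBall, dist_comm, dist_eq_norm]
      exact Real.le_sqrt_of_sq_le h1
    · have := abs_le.1 (abs_le_of_sq_le_sq (by simpa using h2.trans hMρ) hρ)
      constructor <;> linarith [this.1, this.2]

/-- Minimizers for centres `y n → x` subconverge to a minimizer for `x`. -/
theorem exists_subseq_infArgmin (hv : IsBddLsc T M v) (hε : 0 < ε) (hκ : 0 < κ) {ρ : ℝ}
    (hρ : 0 ≤ ρ) (hρt : ρ < t) (hρT : t + ρ < T) (hMρ : 4 * M * κ ≤ ρ ^ 2)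
    {y : ℕ → EuclideanSpace ℝ (Fin N)} (hy : Tendsto y atTop (𝓝 x))
    {z : ℕ → EuclideanSpace ℝ (Fin N) × ℝ} (hz : ∀ n, z n ∈ infArgmin T ε κ v (y n) t) :
    ∃ a ∈ infArgmin T ε κ v x t, ∃ φ : ℕ → ℕ, StrictMono φ ∧
      Tendsto (z ∘ φ) atTop (𝓝 a) := by
  have ht : t ∈ Ioo 0 T := ⟨by linarith, by linarith⟩
  obtain ⟨R, hR⟩ := (Metric.isBounded_range_of_tendsto y hy).subset_closedBall x
  set K : Set (EuclideanSpace ℝ (Fin N) × ℝ) :=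
    Metric.closedBall x (R + √(4 * M * ε)) ×ˢ Icc (t - ρ) (t + ρ) with hK
  have hzK : ∀ n, z n ∈ K := by
    intro n
    obtain ⟨h1, h2⟩ := quad_le_of_mem_infArgmin hv hε hκ ht (hz n)
    refine ⟨?_, ?_⟩
    · have h3 : dist (y n) x ≤ R := hR (mem_range_self n)
      have h4 : dist (z n).1 (y n) ≤ √(4 * M * ε) := by
        rw [dist_comm, dist_eq_norm]
        exact Real.le_sqrt_of_sq_le h1
      exact (dist_triangle _ (y n) _).trans (by linarith)
    · have := abs_le.1 (abs_le_of_sq_le_sq (by simpa using h2.trans hMρ) hρ)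
      constructor <;> linarith [this.1, this.2]
  obtain ⟨a, haK, φ, hφ, hlim⟩ :=
    ((isCompact_closedBall _ _).prod isCompact_Icc).tendsto_subseq hzK
  have haT : a.2 ∈ Ioo 0 T := ⟨by linarith [haK.2.1], by linarith [haK.2.2]⟩
  refine ⟨a, ⟨haT, fun b hb => ?_⟩, φ, hφ, hlim⟩
  have hyφ : Tendsto (y ∘ φ) atTop (𝓝 x) := hy.comp hφ.tendsto_atTop
  set q : EuclideanSpace ℝ (Fin N) × (EuclideanSpace ℝ (Fin N) × ℝ) → ℝ := fun w =>
    1 / (2 * ε) * ‖w.1 - w.2.1‖ ^ 2 + 1 / (2 * κ) * |t - w.2.2| ^ 2 with hq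
  have hqc : Continuous q := by simp only [hq]; fun_prop
  have hb1 : Tendsto (fun n => q (y (φ n), b)) atTop (𝓝 (q (x, b))) :=
    (hqc.tendsto (x, b)).comp (hyφ.prodMk_nhds tendsto_const_nhds)
  have ha1 : Tendsto (fun n => q (y (φ n), z (φ n))) atTop (𝓝 (q (x, a))) :=
    (hqc.tendsto (x, a)).comp (hyφ.prodMk_nhds hlim)
  have hlim1 := (hb1.const_add (v b.1 b.2)).sub ha1
  have hle : v a.1 a.2 ≤ v b.1 b.2 + q (x, b) - q (x, a) := by
    refine le_of_forall_lt fun r hr => ?_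
    obtain ⟨r', hr1, hr2⟩ := exists_between hr
    have h1 : ∀ᶠ z' in 𝓝[univ ×ˢ Icc 0 T] a, r' < v z'.1 z'.2 :=
      hv.lsc a ⟨mem_univ _, Ioo_subset_Icc_self haT⟩ r' hr2
    have h2 : Tendsto (z ∘ φ) atTop (𝓝[univ ×ˢ Icc 0 T] a) :=
      tendsto_nhdsWithin_iff.2 ⟨hlim, Eventually.of_forall fun n =>
        ⟨mem_univ _, Ioo_subset_Icc_self (hz (φ n)).1⟩⟩
    refine hr1.trans_le (ge_of_tendsto hlim1 ?_)
    filter_upwards [h2.eventually h1] with n hn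
    have := (hz (φ n)).2 b hb
    simp only [infCost] at this
    simp only [hq, Function.comp_apply] at hn ⊢
    linarith
  simp only [infCost]
  simp only [hq] at hle
  linarith

theorem isCompact_infArgmin (hv : IsBddLsc T M v) (hε : 0 < ε) (hκ : 0 < κ) {ρ : ℝ}
    (hρ : 0 ≤ ρ) (hρt : ρ < t) (hρT : t + ρ < T) (hMρ : 4 * M * κ ≤ ρ ^ 2) :
    IsCompact (infArgmin T ε κ v x t) :=
  IsSeqCompact.isCompact fun _ hz =>
    exists_subseq_infArgmin hv hε hκ hρ hρt hρT hMρ tendsto_const_nhds hz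

theorem upperSemicontinuous_infConv (hv : IsBddLsc T M v) (hε : 0 < ε) (hκ : 0 < κ) :
    UpperSemicontinuous fun x => infConv T ε κ v x t := by
  refine upperSemicontinuous_ciInf (fun x => bddBelow_infCost hv hε hκ) fun z => ?_
  apply Continuous.upperSemicontinuous
  fun_prop

theorem infConv_le_add_time (hv : IsBddLsc T M v) (hε : 0 < ε) (hκ : 0 < κ) {t' : ℝ}
    (ht : t ∈ Ioo 0 T) (ht' : t' ∈ Ioo 0 T) :
    infConv T ε κ v x t ≤ infConv T ε κ v x t' + T / κ * |t - t'| := by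
  rw [← sub_le_iff_le_add]
  refine le_infConv (ht.1.trans ht.2) fun y hy => ?_
  have h1 := infConv_le (x := x) (t := t) hv hε hκ hy
  simp only [infCost] at h1 ⊢
  have h2 : |t - y.2| ^ 2 - |t' - y.2| ^ 2 ≤ 2 * T * |t - t'| := by
    rw [sq_abs, sq_abs]
    have h3 : (t - y.2) ^ 2 - (t' - y.2) ^ 2 = (t - t') * (t + t' - 2 * y.2) := by ring
    rw [h3]
    refine (le_abs_self _).trans ?_
    rw [abs_mul, mul_comm]
    refine mul_le_mul_of_nonneg_right (abs_le.2 ⟨?_, ?_⟩) (abs_nonneg _) <;>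
      linarith [ht.1, ht.2, ht'.1, ht'.2, hy.1, hy.2]
  have h4 : 1 / (2 * κ) * (|t - y.2| ^ 2 - |t' - y.2| ^ 2) ≤ T / κ * |t - t'| := by
    refine (mul_le_mul_of_nonneg_left h2 (by positivity)).trans (le_of_eq ?_)
    field_simp
  linarith

end infConv

/-! ### The sup-convolution in space -/

section supConv

variable {N : ℕ} {M δ t : ℝ} {f : EuclideanSpace ℝ (Fin N) → ℝ → ℝ}
  {x : EuclideanSpace ℝ (Fin N)}

theorem supConv_le {a : ℝ} (h : ∀ y, f y t - 1 / (2 * δ) * ‖x - y‖ ^ 2 ≤ a) :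
    supConv δ f x t ≤ a :=
  ciSup_le h

theorem le_supConv (hf : ∀ y, |f y t| ≤ M) (hδ : 0 < δ) (y : EuclideanSpace ℝ (Fin N)) :
    f y t - 1 / (2 * δ) * ‖x - y‖ ^ 2 ≤ supConv δ f x t := by
  refine le_ciSup (f := fun y => f y t - 1 / (2 * δ) * ‖x - y‖ ^ 2) ⟨M, ?_⟩ y
  rintro _ ⟨y', rfl⟩
  have h1 := (abs_le.1 (hf y')).2
  have h2 : 0 ≤ 1 / (2 * δ) * ‖x - y'‖ ^ 2 := by positivity
  dsimp only
  linarith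

theorem le_supConv_self (hf : ∀ y, |f y t| ≤ M) (hδ : 0 < δ) :
    f x t ≤ supConv δ f x t := by
  simpa using le_supConv (x := x) hf hδ x

theorem abs_supConv_le (hf : ∀ y, |f y t| ≤ M) (hδ : 0 < δ) : |supConv δ f x t| ≤ M := by
  refine abs_le.2 ⟨(abs_le.1 (hf x)).1.trans (le_supConv_self hf hδ), supConv_le fun y => ?_⟩
  have h1 := (abs_le.1 (hf y)).2
  have h2 : 0 ≤ 1 / (2 * δ) * ‖x - y‖ ^ 2 := by positivity
  linarith

theorem norm_sq_le_of_le_quad (hf : ∀ y, |f y t| ≤ M) (hδ : 0 < δ)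
    {y : EuclideanSpace ℝ (Fin N)} (hy : f x t ≤ f y t - 1 / (2 * δ) * ‖x - y‖ ^ 2) :
    ‖x - y‖ ^ 2 ≤ 4 * M * δ := by
  have h1 := (abs_le.1 (hf x)).1
  have h2 := (abs_le.1 (hf y)).2
  have h3 : 1 / (2 * δ) * ‖x - y‖ ^ 2 ≤ 2 * M := by linarith
  rw [div_mul_eq_mul_div, one_mul, div_le_iff₀ (by positivity)] at h3
  linarith

theorem exists_supConv_eq (hf : ∀ y, |f y t| ≤ M) (hδ : 0 < δ)
    (husc : UpperSemicontinuous fun y => f y t) (x : EuclideanSpace ℝ (Fin N)) :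
    ∃ y, supConv δ f x t = f y t - 1 / (2 * δ) * ‖x - y‖ ^ 2 := by
  set K := Metric.closedBall x (√(4 * M * δ)) with hK
  have hxK : x ∈ K := Metric.mem_closedBall_self (Real.sqrt_nonneg _)
  have hq : Continuous fun y => -(1 / (2 * δ) * ‖x - y‖ ^ 2) := by fun_prop
  have husc' : UpperSemicontinuousOn (fun y => f y t - 1 / (2 * δ) * ‖x - y‖ ^ 2) K := by
    simp only [sub_eq_add_neg]
    exact (husc.add hq.upperSemicontinuous).upperSemicontinuousOn K
  obtain ⟨y, hyK, hy⟩ := husc'.exists_isMaxOn ⟨x, hxK⟩ (isCompact_closedBall _ _)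
  refine ⟨y, le_antisymm (supConv_le fun y' => ?_) (le_supConv hf hδ y)⟩
  by_cases hyK' : y' ∈ K
  · exact hy hyK'
  · by_contra! hlt
    apply hyK'
    have hx : f x t - 1 / (2 * δ) * ‖x - x‖ ^ 2 ≤ f y t - 1 / (2 * δ) * ‖x - y‖ ^ 2 := hy hxK
    rw [sub_self, norm_zero] at hx
    rw [hK, Metric.mem_closedBall, dist_comm, dist_eq_norm]
    exact Real.le_sqrt_of_sq_le (norm_sq_le_of_le_quad hf hδ (by linarith))

end supConv

/-! ### Decomposition of the inf-sup-convolution -/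

section decomposition

variable {N : ℕ} {T M c δ κ t : ℝ} {v : EuclideanSpace ℝ (Fin N) → ℝ → ℝ}
  {x y : EuclideanSpace ℝ (Fin N)}

/-- First-order condition at a point `y` where `V - |x - ·|²/(2δ)` is maximal, with
`V = infConv T c κ v · t`. Each minimizer `z` for `V(y)` gives the smooth upper barrier
with gradient `(y - z)/c` at `y`, and the superdifferential of the infimum `V` is the convex hull of these gradients (Danskin's
theorem); the maximality of `y` puts `(y - x)/δ` into it. The proof separates and moves `y` along
the separating direction, which would increase the function. -/
theorem smul_sub_mem_convexHull_of_isMax (hv : IsBddLsc T M v) (hc : 0 < c) (hδ : 0 < δ)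
    (hκ : 0 < κ) {ρ : ℝ} (hρ : 0 ≤ ρ) (hρt : ρ < t) (hρT : t + ρ < T) (hMρ : 4 * M * κ ≤ ρ ^ 2)
    (hy : ∀ y', infConv T c κ v y' t - 1 / (2 * δ) * ‖x - y'‖ ^ 2 ≤
      infConv T c κ v y t - 1 / (2 * δ) * ‖x - y‖ ^ 2) :
    (1 / δ) • (y - x) ∈ convexHull ℝ
      ((fun z : EuclideanSpace ℝ (Fin N) × ℝ => (1 / c) • (y - z.1)) ''
        infArgmin T c κ v y t) := by
  by_contra hmem
  have hcomp := isCompact_convexHull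
    ((isCompact_infArgmin (x := y) hv hc hκ hρ hρt hρT hMρ).image
      (f := fun z : EuclideanSpace ℝ (Fin N) × ℝ => (1 / c) • (y - z.1)) (by fun_prop))
  obtain ⟨f, u, hfu, hfb⟩ := geometric_hahn_banach_point_closed (convex_convexHull ℝ _)
    hcomp.isClosed hmem
  set k := (InnerProductSpace.toDual ℝ (EuclideanSpace ℝ (Fin N))).symm f with hk
  have hkf : ∀ b, f b = ⟪k, b⟫ := fun b => by
    rw [hk, InnerProductSpace.toDual_symm_apply]
  -- Move from `y` in the separating direction `k` by steps `θ n → 0`.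
  set θ : ℕ → ℝ := fun n => 1 / ((n : ℝ) + 1) with hθ
  have hθ0 : Tendsto θ atTop (𝓝 0) := tendsto_one_div_add_atTop_nhds_zero_nat
  have hθpos : ∀ n, 0 < θ n := fun n => by positivity
  have hyn : Tendsto (fun n => y + θ n • k) atTop (𝓝 y) := by
    simpa using (hθ0.smul_const k).const_add y
  choose z hz using fun n =>
    infArgmin_nonempty (x := y + θ n • k) hv hc hκ hρ hρt hρT hMρ
  obtain ⟨a, ha, φ, hφ, hlim⟩ := exists_subseq_infArgmin hv hc hκ hρ hρt hρT hMρ hyn hz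
  have hua : u < f ((1 / c) • (y - a.1)) := hfb _ (subset_convexHull ℝ _ ⟨a, ha, rfl⟩)
  have hcont : Continuous fun z : EuclideanSpace ℝ (Fin N) × ℝ => f ((1 / c) • (y - z.1)) := by
    fun_prop
  have hev1 : ∀ᶠ n in atTop, u < f ((1 / c) • (y - (z (φ n)).1)) :=
    ((hcont.tendsto a).comp hlim).eventually (lt_mem_nhds hua)
  have hev2 : ∀ᶠ n in atTop, f ((1 / δ) • (y - x)) + 1 / (2 * δ) * ‖k‖ ^ 2 * θ (φ n) < u := by
    have h1 : Tendsto (fun n => f ((1 / δ) • (y - x)) + 1 / (2 * δ) * ‖k‖ ^ 2 * θ (φ n)) atTop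
        (𝓝 (f ((1 / δ) • (y - x)) + 1 / (2 * δ) * ‖k‖ ^ 2 * 0)) :=
      ((hθ0.comp hφ.tendsto_atTop).const_mul _).const_add _
    rw [mul_zero, add_zero] at h1
    exact h1.eventually (gt_mem_nhds hfu)
  obtain ⟨n, h1, h2⟩ := (hev1.and hev2).exists
  set r := θ (φ n) with hr
  set b := z (φ n) with hb
  have hr0 : 0 < r := hθpos _
  have hV1 := infConv_eq_infCost hv hc hκ (hz (φ n))
  have hV2 := infConv_le (x := y) (t := t) hv hc hκ (hz (φ n)).1
  have hmax := hy (y + r • k)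
  rw [← hr, ← hb] at hV1
  rw [← hb] at hV2
  rw [hV1] at hmax
  simp only [infCost] at hmax hV2
  have e1 : ‖y + r • k - b.1‖ ^ 2 = ‖y - b.1‖ ^ 2 + 2 * (r * ⟪k, y - b.1⟫) + r ^ 2 * ‖k‖ ^ 2 := by
    rw [show y + r • k - b.1 = (y - b.1) + r • k by abel, norm_add_sq_real, norm_smul,
      inner_smul_right, real_inner_comm, mul_pow, Real.norm_eq_abs, sq_abs]
  have e2 : ‖x - (y + r • k)‖ ^ 2 = ‖x - y‖ ^ 2 + 2 * (r * ⟪k, y - x⟫) + r ^ 2 * ‖k‖ ^ 2 := by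
    rw [norm_sub_rev, norm_sub_rev x y,
      show y + r • k - x = (y - x) + r • k by abel, norm_add_sq_real, norm_smul,
      inner_smul_right, real_inner_comm, mul_pow, Real.norm_eq_abs, sq_abs]
  rw [e1, e2] at hmax
  rw [hkf, inner_smul_right] at h1 h2
  have e3 : 1 / (2 * c) * (‖y - b.1‖ ^ 2 + 2 * (r * ⟪k, y - b.1⟫) + r ^ 2 * ‖k‖ ^ 2) =
      1 / (2 * c) * ‖y - b.1‖ ^ 2 + r * (1 / c * ⟪k, y - b.1⟫) +
        1 / (2 * c) * (r ^ 2 * ‖k‖ ^ 2) := by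
    field_simp
  have e4 : 1 / (2 * δ) * (‖x - y‖ ^ 2 + 2 * (r * ⟪k, y - x⟫) + r ^ 2 * ‖k‖ ^ 2) =
      1 / (2 * δ) * ‖x - y‖ ^ 2 + r * (1 / δ * ⟪k, y - x⟫ + 1 / (2 * δ) * ‖k‖ ^ 2 * r) := by
    field_simp
    ring
  rw [e3, e4] at hmax
  have e5 : 0 ≤ 1 / (2 * c) * (r ^ 2 * ‖k‖ ^ 2) := by positivity
  have e6 := mul_lt_mul_of_pos_left h1 hr0
  have e7 := mul_lt_mul_of_pos_left h2 hr0
  linarith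

/-- A decomposition of `w = (v_{c,κ})^δ` at `(x,t)`: the supremum is attained at `y`, and the
gradient `(y - x)/δ` is the average, with weights `μ i`, of the gradients `(y - z i)/c` coming from
minimizers `z i` of the inf-convolution at `(y,t)`. -/
structure IsDecomposition (T c δ κ : ℝ) (v : EuclideanSpace ℝ (Fin N) → ℝ → ℝ)
    (x : EuclideanSpace ℝ (Fin N)) (t : ℝ) (y : EuclideanSpace ℝ (Fin N))
    {ι : Type} [Fintype ι] (μ : ι → ℝ) (z : ι → EuclideanSpace ℝ (Fin N) × ℝ) : Prop where
  supConv_eq : supConv δ (infConv T c κ v) x t =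
    infConv T c κ v y t - 1 / (2 * δ) * ‖x - y‖ ^ 2
  nonneg : ∀ i, 0 ≤ μ i
  sum_eq_one : ∑ i, μ i = 1
  mem : ∀ i, z i ∈ infArgmin T c κ v y t
  sum_smul : ∑ i, μ i • ((1 / c) • (y - (z i).1)) = (1 / δ) • (y - x)

theorem exists_isDecomposition (hv : IsBddLsc T M v) (hc : 0 < c) (hδ : 0 < δ)
    (hκ : 0 < κ) {ρ : ℝ} (hρ : 0 ≤ ρ) (hρt : ρ < t) (hρT : t + ρ < T) (hMρ : 4 * M * κ ≤ ρ ^ 2)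
    (x : EuclideanSpace ℝ (Fin N)) :
    ∃ (y : EuclideanSpace ℝ (Fin N)) (ι : Type) (_ : Fintype ι) (μ : ι → ℝ)
      (z : ι → EuclideanSpace ℝ (Fin N) × ℝ), IsDecomposition T c δ κ v x t y μ z := by
  have ht : t ∈ Ioo 0 T := ⟨by linarith, by linarith⟩
  have hf : ∀ y, |infConv T c κ v y t| ≤ M := fun y => abs_infConv_le hv hc hκ ht
  obtain ⟨y, hy⟩ := exists_supConv_eq hf hδ (upperSemicontinuous_infConv hv hc hκ) x
  have hmem := smul_sub_mem_convexHull_of_isMax (x := x) (y := y) hv hc hδ hκ hρ hρt hρT hMρ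
    fun y' => by rw [← hy]; exact le_supConv hf hδ y'
  obtain ⟨ι, _, μ, g, hμ, hμ1, hg, hsum⟩ := mem_convexHull_iff_exists_fintype.1 hmem
  choose z hz hzg using hg
  refine ⟨y, ι, inferInstance, μ, z, hy, hμ, hμ1, hz, ?_⟩
  rw [← hsum]
  exact Finset.sum_congr rfl fun i _ => by rw [← hzg i]

/-- Cauchy–Schwarz; one half of the semigroup property of convolution with parabolas. -/
theorem norm_sq_div_add_le {E : Type*} [SeminormedAddCommGroup E] {ε δ : ℝ} (hε : 0 < ε)
    (hδ : 0 < δ) (m e : E) :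
    1 / (2 * (ε + δ)) * ‖m‖ ^ 2 ≤ 1 / (2 * δ) * ‖m - e‖ ^ 2 + 1 / (2 * ε) * ‖e‖ ^ 2 := by
  have h1 : ‖m‖ ≤ ‖m - e‖ + ‖e‖ := by simpa using norm_add_le (m - e) e
  have h2 : ‖m‖ ^ 2 ≤ (‖m - e‖ + ‖e‖) ^ 2 := by gcongr
  refine (mul_le_mul_of_nonneg_left h2 (by positivity)).trans ?_
  rw [← sub_nonneg]
  have : 1 / (2 * δ) * ‖m - e‖ ^ 2 + 1 / (2 * ε) * ‖e‖ ^ 2 -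
      1 / (2 * (ε + δ)) * (‖m - e‖ + ‖e‖) ^ 2 =
      (ε * ‖m - e‖ - δ * ‖e‖) ^ 2 / (2 * ε * δ * (ε + δ)) := by
    field_simp
    ring
  rw [this]
  positivity

variable {ι : Type} [Fintype ι] {μ : ι → ℝ} {z : ι → EuclideanSpace ℝ (Fin N) × ℝ} {ε : ℝ}

/-- The main comparison: the increments of `w` at `(x,t)` are bounded by the averaged increments of
`v` at the base points `z i`, for any common displacement `a` of the base points. The displacement
`a = h` serves the nonlocal term, `a = 0` the derivatives. -/
theorem IsDecomposition.supConv_add_le (hd : IsDecomposition T (ε + δ) δ κ v x t y μ z)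
    (hv : IsBddLsc T M v) (hε : 0 < ε) (hδ : 0 < δ) (hκ : 0 < κ)
    (h a : EuclideanSpace ℝ (Fin N)) (t' : ℝ) :
    supConv δ (infConv T (ε + δ) κ v) (x + h) t' ≤
      supConv δ (infConv T (ε + δ) κ v) x t +
        ∑ i, μ i * (v ((z i).1 + a) (z i).2 - v (z i).1 (z i).2) +
        ∑ i, μ i * (1 / (2 * κ) * (|t' - (z i).2| ^ 2 - |t - (z i).2| ^ 2)) +
        ⟪(1 / δ) • (y - x), h - a⟫ + 1 / (2 * ε) * ‖h - a‖ ^ 2 := by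
  have hc : 0 < ε + δ := by positivity
  refine supConv_le fun y' => ?_
  have hi : ∀ i, infConv T (ε + δ) κ v y' t' ≤ infConv T (ε + δ) κ v y t +
      (v ((z i).1 + a) (z i).2 - v (z i).1 (z i).2) +
      1 / (2 * κ) * (|t' - (z i).2| ^ 2 - |t - (z i).2| ^ 2) +
      ⟪(1 / (ε + δ)) • (y - (z i).1), y' - y - a⟫ +
      1 / (2 * (ε + δ)) * ‖y' - y - a‖ ^ 2 := by
    intro i
    have h1 := infConv_le (x := y') (t := t') (y := ((z i).1 + a, (z i).2)) hv hc hκ (hd.mem i).1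
    rw [infConv_eq_infCost hv hc hκ (hd.mem i)]
    simp only [infCost] at h1 ⊢
    have e1 : ‖y' - ((z i).1 + a)‖ ^ 2 = ‖y - (z i).1‖ ^ 2 +
        2 * ⟪y - (z i).1, y' - y - a⟫ + ‖y' - y - a‖ ^ 2 := by
      rw [← norm_add_sq_real]
      congr 2
      abel
    rw [e1] at h1
    rw [real_inner_smul_left]
    refine h1.trans (le_of_eq ?_)
    field_simp
    ring
  have hsum : infConv T (ε + δ) κ v y' t' ≤ infConv T (ε + δ) κ v y t +
      ∑ i, μ i * (v ((z i).1 + a) (z i).2 - v (z i).1 (z i).2) +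
      ∑ i, μ i * (1 / (2 * κ) * (|t' - (z i).2| ^ 2 - |t - (z i).2| ^ 2)) +
      ⟪(1 / δ) • (y - x), y' - y - a⟫ + 1 / (2 * (ε + δ)) * ‖y' - y - a‖ ^ 2 := by
    generalize 1 / (2 * (ε + δ)) * ‖y' - y - a‖ ^ 2 = C at hi ⊢
    have h1 := Finset.sum_le_sum fun i (_ : i ∈ Finset.univ) =>
      mul_le_mul_of_nonneg_left (hi i) (hd.nonneg i)
    simp only [mul_add, Finset.sum_add_distrib, ← Finset.sum_mul, hd.sum_eq_one, one_mul] at h1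
    rw [← hd.sum_smul, sum_inner]
    simp only [real_inner_smul_left _ _ (μ _)]
    exact h1
  have h2 := norm_sq_div_add_le hε hδ (y' - y - a) (h - a)
  rw [hd.supConv_eq]
  have e2 : ‖x + h - y'‖ ^ 2 = ‖x - y‖ ^ 2 + 2 * ⟪y - x, y' - y - h⟫ + ‖y' - y - h‖ ^ 2 := by
    rw [norm_sub_rev x y, ← norm_add_sq_real, norm_sub_rev]
    congr 2
    abel
  have e3 : y' - y - a - (h - a) = y' - y - h := by abel
  have e4 : (⟪(1 / δ) • (y - x), y' - y - a⟫ : ℝ) =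
      ⟪(1 / δ) • (y - x), h - a⟫ + 1 / δ * ⟪y - x, y' - y - h⟫ := by
    rw [← real_inner_smul_left, ← inner_add_right]
    congr 1
    abel
  rw [e3] at h2
  rw [e4] at hsum
  rw [e2]
  have e5 : 1 / (2 * δ) * (‖x - y‖ ^ 2 + 2 * ⟪y - x, y' - y - h⟫ + ‖y' - y - h‖ ^ 2) =
      1 / (2 * δ) * ‖x - y‖ ^ 2 + 1 / δ * ⟪y - x, y' - y - h⟫ +
        1 / (2 * δ) * ‖y' - y - h‖ ^ 2 := by
    field_simp
  rw [e5]
  linarith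

/-- Spatial increments of `w` are at most the averaged increments of `v` at the base points. -/
theorem IsDecomposition.supConv_sub_le (hd : IsDecomposition T (ε + δ) δ κ v x t y μ z)
    (hv : IsBddLsc T M v) (hε : 0 < ε) (hδ : 0 < δ) (hκ : 0 < κ)
    (h : EuclideanSpace ℝ (Fin N)) :
    supConv δ (infConv T (ε + δ) κ v) (x + h) t - supConv δ (infConv T (ε + δ) κ v) x t ≤
      ∑ i, μ i * (v ((z i).1 + h) (z i).2 - v (z i).1 (z i).2) := by
  have := hd.supConv_add_le hv hε hδ hκ h h t
  simp only [sub_self, mul_zero, Finset.sum_const_zero, inner_zero_right, norm_zero] at this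
  linarith

/-- `w(·,t)` lies between two parabolas touching it at `x`. -/
theorem IsDecomposition.abs_supConv_sub_inner_le
    (hd : IsDecomposition T (ε + δ) δ κ v x t y μ z) (hv : IsBddLsc T M v) (hε : 0 < ε)
    (hδ : 0 < δ) (hκ : 0 < κ) (ht : t ∈ Ioo 0 T) (h : EuclideanSpace ℝ (Fin N)) :
    |supConv δ (infConv T (ε + δ) κ v) (x + h) t - supConv δ (infConv T (ε + δ) κ v) x t -
      ⟪(1 / δ) • (y - x), h⟫| ≤ (1 / (2 * ε) + 1 / (2 * δ)) * ‖h‖ ^ 2 := by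
  have h1 := hd.supConv_add_le hv hε hδ hκ h 0 t
  simp only [add_zero, sub_self, mul_zero, Finset.sum_const_zero, sub_zero] at h1
  have h2 := le_supConv (x := x + h) (f := infConv T (ε + δ) κ v)
    (fun y => abs_infConv_le hv (by positivity) hκ ht) hδ y
  have e1 : 1 / (2 * δ) * ‖x + h - y‖ ^ 2 =
      1 / (2 * δ) * ‖x - y‖ ^ 2 - ⟪(1 / δ) • (y - x), h⟫ + 1 / (2 * δ) * ‖h‖ ^ 2 := by
    rw [show x + h - y = h - (y - x) by abel, norm_sub_sq_real, real_inner_smul_left,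
      norm_sub_rev x y, real_inner_comm]
    field_simp
    ring
  rw [e1] at h2
  have h3 := hd.supConv_eq
  have e2 : 0 ≤ 1 / (2 * δ) * ‖h‖ ^ 2 := by positivity
  have e3 : 0 ≤ 1 / (2 * ε) * ‖h‖ ^ 2 := by positivity
  rw [abs_le, add_mul]
  constructor <;> linarith

theorem IsDecomposition.hasGradientAt
    (hd : IsDecomposition T (ε + δ) δ κ v x t y μ z) (hv : IsBddLsc T M v) (hε : 0 < ε)
    (hδ : 0 < δ) (hκ : 0 < κ) (ht : t ∈ Ioo 0 T) :
    HasGradientAt (fun x' => supConv δ (infConv T (ε + δ) κ v) x' t) ((1 / δ) • (y - x)) x := by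
  rw [hasGradientAt_iff_hasFDerivAt, hasFDerivAt_iff_isLittleO_nhds_zero]
  refine Asymptotics.IsBigO.trans_isLittleO
    (g := fun h : EuclideanSpace ℝ (Fin N) => ‖h‖ ^ 2) ?_ ?_
  · refine Asymptotics.IsBigO.of_bound (1 / (2 * ε) + 1 / (2 * δ))
      (Eventually.of_forall fun h => ?_)
    have := hd.abs_supConv_sub_inner_le hv hε hδ hκ ht h
    rw [norm_pow, norm_norm, Real.norm_eq_abs, InnerProductSpace.toDual_apply_apply]
    exact this
  · simpa using Asymptotics.isLittleO_norm_pow_id (E' := EuclideanSpace ℝ (Fin N)) one_lt_two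

/-- In time `w(x,·)` is touched from above at `t` by an average of parabolas, so its derivative, if
it exists, is the average of theirs. -/
theorem IsDecomposition.eq_of_hasDerivAt
    (hd : IsDecomposition T (ε + δ) δ κ v x t y μ z) (hv : IsBddLsc T M v) (hε : 0 < ε)
    (hδ : 0 < δ) (hκ : 0 < κ) {a : ℝ}
    (ha : HasDerivAt (fun τ => supConv δ (infConv T (ε + δ) κ v) x τ) a t) :
    a = ∑ i, μ i * (1 / κ * (t - (z i).2)) := by
  set w := fun τ => supConv δ (infConv T (ε + δ) κ v) x τ with hw
  set g : ℝ → ℝ := fun τ =>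
    (∑ i, μ i * (1 / (2 * κ) * ((τ - (z i).2) ^ 2 - (t - (z i).2) ^ 2))) - w τ with hg
  have hmin : IsLocalMin g t := by
    refine Eventually.of_forall fun τ => ?_
    have := hd.supConv_add_le hv hε hδ hκ 0 0 τ
    simp only [add_zero, sub_self, mul_zero, Finset.sum_const_zero, inner_zero_right, norm_zero,
      sq_abs] at this
    simp only [hg, hw, sub_self, mul_zero, Finset.sum_const_zero]
    linarith
  have hder : HasDerivAt g ((∑ i, μ i * (1 / κ * (t - (z i).2))) - a) t := by
    refine (HasDerivAt.fun_sum fun i _ => ?_).sub ha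
    have h1 := (((hasDerivAt_id t).sub_const (z i).2).pow 2).sub_const ((t - (z i).2) ^ 2)
    have h2 := (h1.const_mul (1 / (2 * κ))).const_mul (μ i)
    refine h2.congr_deriv ?_
    simp only [id, Nat.cast_ofNat, Nat.add_one_sub_one, pow_one, mul_one]
    field_simp
  linarith [hmin.hasDerivAt_eq_zero hder]

end decomposition

/-! ### Principal values -/

section nonlocal

variable {N : ℕ} {s r : ℝ} {ψ : EuclideanSpace ℝ (Fin N) → ℝ}
  {x : EuclideanSpace ℝ (Fin N)} {A : Set (EuclideanSpace ℝ (Fin N))}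

theorem normConst_nonneg (N : ℕ) (hs0 : 0 < s) (hs1 : s < 1) : 0 ≤ normConst N s := by
  have h1 : 0 < Real.Gamma ((N : ℝ) / 2 + s) := Real.Gamma_pos_of_pos (by positivity)
  have h2 : 0 < Real.Gamma (1 - s) := Real.Gamma_pos_of_pos (by linarith)
  unfold normConst
  positivity

/-- The kernel is integrable away from its singularity. -/
theorem integrableOn_compl_ball_inv_norm_rpow (hs0 : 0 < s) (hr : 0 < r)
    (x : EuclideanSpace ℝ (Fin N)) :
    IntegrableOn (fun y => 1 / ‖x - y‖ ^ ((N : ℝ) + 2 * s)) (Metric.ball x r)ᶜ := by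
  set a : ℝ := (N : ℝ) + 2 * s with ha
  have ha0 : 0 < a := by positivity
  have h1 : Integrable fun y : EuclideanSpace ℝ (Fin N) => (1 + ‖x - y‖) ^ (-a) :=
    (integrable_one_add_norm (E := EuclideanSpace ℝ (Fin N)) (μ := volume)
      (by simp [ha, hs0])).comp_sub_left x
  refine (h1.const_mul (((1 + r) / r) ^ a)).integrableOn.mono'
    (by fun_prop : Measurable _).aestronglyMeasurable ?_
  refine (ae_restrict_iff' Metric.isOpen_ball.measurableSet.compl).2 (Eventually.of_forall ?_)
  intro y hy
  have hy' : r ≤ ‖x - y‖ := by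
    simpa [dist_comm, dist_eq_norm] using hy
  have hn : 0 < ‖x - y‖ := hr.trans_le hy'
  rw [Real.norm_of_nonneg (by positivity), Real.rpow_neg (by positivity), ← div_eq_mul_inv,
    ← Real.div_rpow (by positivity) (by positivity), one_div,
    ← Real.inv_rpow (by positivity)]
  refine Real.rpow_le_rpow (by positivity) ?_ ha0.le
  rw [inv_eq_one_div, div_div, div_le_div_iff₀ (by positivity) (by positivity)]
  nlinarith

/-- Near its singularity the kernel is integrable against `|x - y|²`, because `s < 1`. -/
theorem integrableOn_ball_norm_sq_div [Nontrivial (EuclideanSpace ℝ (Fin N))] (hs1 : s < 1)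
    (x : EuclideanSpace ℝ (Fin N)) (r : ℝ) :
    IntegrableOn (fun y => ‖x - y‖ ^ 2 / ‖x - y‖ ^ ((N : ℝ) + 2 * s)) (Metric.ball x r) := by
  have h0 : IntegrableOn
      (fun y : EuclideanSpace ℝ (Fin N) => ‖y‖ ^ 2 / ‖y‖ ^ ((N : ℝ) + 2 * s))
      (Metric.ball 0 r) := by
    refine (integrableOn_fun_norm_addHaar volume
      (f := fun y : ℝ => y ^ 2 / y ^ ((N : ℝ) + 2 * s))).2 ?_
    have h1 : IntegrableOn (fun y : ℝ => y ^ (1 - 2 * s)) (Ioo 0 r) := by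
      rcases le_or_gt r 0 with hr | hr
      · simp [Ioo_eq_empty_of_le hr]
      · exact ((intervalIntegrable_iff_integrableOn_Ioo_of_le hr.le).1
          (intervalIntegral.intervalIntegrable_rpow' (by linarith)))
    refine h1.congr_fun (fun y hy => ?_) measurableSet_Ioo
    have hy0 : 0 < y := hy.1
    have hN : 1 ≤ N := by
      have := Module.finrank_pos (R := ℝ) (M := EuclideanSpace ℝ (Fin N))
      simpa [finrank_euclideanSpace, Nat.succ_le_iff] using this
    simp only [smul_eq_mul, finrank_euclideanSpace, Fintype.card_fin]
    rw [← Real.rpow_natCast y 2, ← Real.rpow_natCast y (N - 1), ← Real.rpow_sub hy0,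
      ← Real.rpow_add hy0]
    congr 1
    push_cast [hN]
    ring
  have h2 := ((Measure.measurePreserving_sub_left volume x).integrableOn_comp_preimage
    (MeasurableEquiv.subLeft x).measurableEmbedding).2 h0
  have h3 : (fun y => x - y) ⁻¹' Metric.ball 0 r = Metric.ball x r := by
    ext y
    simp [dist_eq_norm, norm_sub_rev]
  rw [h3] at h2
  exact h2

/-- The symmetrized integrand of the fractional Laplacian: a second-order difference of `ψ` at `x`
over the kernel. The reflection of `y` in `x` is written `x + x - y`. -/
noncomputable def secondDiff {N : ℕ} (s : ℝ) (ψ : EuclideanSpace ℝ (Fin N) → ℝ)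
    (x y : EuclideanSpace ℝ (Fin N)) : ℝ :=
  (2 * ψ x - ψ y - ψ (x + x - y)) / ‖x - y‖ ^ ((N : ℝ) + 2 * s)

theorem tendsto_setIntegral_diff_ball {F : EuclideanSpace ℝ (Fin N) → ℝ} (hF : IntegrableOn F A)
    (hFx : F x = 0) :
    Tendsto (fun ω : ℝ => ∫ y in A \ Metric.ball x ω, F y) (𝓝[>] 0) (𝓝 (∫ y in A, F y)) := by
  have h1 : ∀ ω : ℝ, ∫ y in A \ Metric.ball x ω, F y =
      ∫ y in A, (Metric.ball x ω)ᶜ.indicator F y := fun ω => by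
    rw [setIntegral_indicator Metric.isOpen_ball.measurableSet.compl, sdiff_eq]
  simp only [h1]
  refine tendsto_integral_filter_of_dominated_convergence (fun y => ‖F y‖)
    (Eventually.of_forall fun ω =>
      hF.aestronglyMeasurable.indicator Metric.isOpen_ball.measurableSet.compl)
    (Eventually.of_forall fun ω => Eventually.of_forall fun y => norm_indicator_le_norm_self _ _)
    hF.norm (Eventually.of_forall fun y => ?_)
  by_cases hy : y = x
  · subst hy
    have : ∀ ω : ℝ, (Metric.ball y ω)ᶜ.indicator F y = F y := fun ω => by
      by_cases h : y ∈ (Metric.ball y ω)ᶜ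
      · rw [indicator_of_mem h]
      · rw [indicator_of_notMem h, hFx]
    simp only [this]
    exact tendsto_const_nhds
  · refine tendsto_const_nhds.congr' ?_
    filter_upwards [Ioo_mem_nhdsGT (dist_pos.2 hy)] with ω hω
    rw [indicator_of_mem]
    simpa using hω.2.le

/-- On a set symmetric about `x` the reflection in `x` removes the first-order part, so that the
principal value is half the absolutely convergent integral of the second-order difference. -/
theorem hasNonlocal_of_integrableOn_secondDiff
    (hA : (fun y => x + x - y) ⁻¹' A = A)
    (hint : ∀ ω : ℝ, 0 < ω → IntegrableOn (kernelDiff s ψ x) (A \ Metric.ball x ω))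
    (hsecond : IntegrableOn (secondDiff s ψ x) A) :
    HasNonlocal s A ψ x (normConst N s * (1 / 2 * ∫ y in A, secondDiff s ψ x y)) := by
  refine ⟨hint, ?_⟩
  have h0 : secondDiff s ψ x x = 0 := by
    rw [secondDiff, add_sub_cancel_right]
    ring
  refine (((tendsto_setIntegral_diff_ball hsecond h0).const_mul (1 / 2)).const_mul
    (normConst N s)).congr' ?_
  filter_upwards [self_mem_nhdsWithin] with ω hω
  congr 1
  set B := A \ Metric.ball x ω with hB
  have hn : ∀ y, ‖x - (x + x - y)‖ = ‖x - y‖ := fun y => by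
    rw [norm_sub_rev x y]
    congr 1
    abel
  have hrefl : (fun y => x + x - y) ⁻¹' B = B := by
    rw [hB, preimage_sdiff, hA]
    congr 1
    ext y
    simp only [mem_preimage, Metric.mem_ball, dist_eq_norm]
    rw [norm_sub_rev, hn, norm_sub_rev]
  have hmp := Measure.measurePreserving_sub_left
    (volume : Measure (EuclideanSpace ℝ (Fin N))) (x + x)
  have hemb := (MeasurableEquiv.subLeft (x + x)).measurableEmbedding
  have h1 : ∫ y in B, kernelDiff s ψ x (x + x - y) = ∫ y in B, kernelDiff s ψ x y := by
    have := hmp.setIntegral_preimage_emb hemb (kernelDiff s ψ x) B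
    rwa [hrefl] at this
  have h2 : IntegrableOn (fun y => kernelDiff s ψ x (x + x - y)) B := by
    have := (hmp.integrableOn_comp_preimage hemb).2 (hint ω hω)
    rwa [← hB, hrefl] at this
  have h3 : ∀ y, secondDiff s ψ x y = kernelDiff s ψ x y + kernelDiff s ψ x (x + x - y) := by
    intro y
    simp only [secondDiff, kernelDiff, hn]
    ring
  simp only [h3]
  rw [integral_add (hint ω hω) h2, h1]
  ring

theorem integrableOn_kernelDiff_compl_ball {B : ℝ} (hs0 : 0 < s) (hψm : Measurable ψ)
    (hψ : ∀ y, |ψ y| ≤ B) (x : EuclideanSpace ℝ (Fin N)) (hr : 0 < r) :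
    IntegrableOn (kernelDiff s ψ x) (Metric.ball x r)ᶜ := by
  refine ((integrableOn_compl_ball_inv_norm_rpow hs0 hr x).const_mul (2 * B)).mono' ?_
    (Eventually.of_forall fun y => ?_)
  · have : Measurable (kernelDiff s ψ x) := by
      unfold kernelDiff
      fun_prop
    exact this.aestronglyMeasurable
  · have h1 := abs_le.1 (hψ x)
    have h2 := abs_le.1 (hψ y)
    have h3 : 0 ≤ ‖x - y‖ ^ ((N : ℝ) + 2 * s) := by positivity
    rw [kernelDiff, norm_div, Real.norm_of_nonneg h3, Real.norm_eq_abs, mul_one_div]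
    refine div_le_div_of_nonneg_right (abs_le.2 ⟨?_, ?_⟩) h3 <;> linarith

theorem hasNonlocal_compl_ball (hr : 0 < r)
    (hint : IntegrableOn (kernelDiff s ψ x) (Metric.ball x r)ᶜ) :
    HasNonlocal s (Metric.ball x r)ᶜ ψ x
      (normConst N s * ∫ y in (Metric.ball x r)ᶜ, kernelDiff s ψ x y) := by
  refine ⟨fun ω _ => hint.mono_set sdiff_subset, tendsto_const_nhds.congr' ?_⟩
  filter_upwards [Ioo_mem_nhdsGT hr] with ω hω
  congr 3
  refine (sdiff_eq_left.2 ?_).symm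
  exact disjoint_compl_left_iff_subset.2 (Metric.ball_subset_ball hω.2.le)

/-- A bounded function that lies between two parabolas touching it at `x` has a fractional Laplacian
there. -/
theorem exists_hasFracLaplacian [Nontrivial (EuclideanSpace ℝ (Fin N))] {B C : ℝ}
    (hs0 : 0 < s) (hs1 : s < 1) (hψm : Measurable ψ) (hψ : ∀ y, |ψ y| ≤ B)
    {q : EuclideanSpace ℝ (Fin N)}
    (hC : ∀ h, |ψ (x + h) - ψ x - inner ℝ q h| ≤ C * ‖h‖ ^ 2) :
    ∃ L, HasFracLaplacian s ψ x L := by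
  refine ⟨_, hasNonlocal_of_integrableOn_secondDiff preimage_univ (fun ω hω => ?_) ?_⟩
  · rw [← compl_eq_univ_sdiff]
    exact integrableOn_kernelDiff_compl_ball hs0 hψm hψ x hω
  · have hm : Measurable (secondDiff s ψ x) := by
      have : Measurable fun y => ψ (x + x - y) := hψm.comp (by fun_prop)
      unfold secondDiff
      fun_prop
    rw [← union_compl_self (Metric.ball x 1)]
    refine IntegrableOn.union ?_ ?_
    · refine ((integrableOn_ball_norm_sq_div hs1 x 1).const_mul (2 * C)).mono'
        hm.aestronglyMeasurable (Eventually.of_forall fun y => ?_)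
      have h1 := abs_le.1 (hC (y - x))
      have h2 := abs_le.1 (hC (x - y))
      have h3 : 0 ≤ ‖x - y‖ ^ ((N : ℝ) + 2 * s) := by positivity
      have h4 : (inner ℝ q (y - x) : ℝ) = -inner ℝ q (x - y) := by
        rw [← inner_neg_right, neg_sub]
      rw [add_sub_cancel, norm_sub_rev, h4] at h1
      rw [show x + (x - y) = x + x - y by abel] at h2
      rw [secondDiff, norm_div, Real.norm_of_nonneg h3, Real.norm_eq_abs, ← mul_div_assoc]
      refine div_le_div_of_nonneg_right (abs_le.2 ⟨?_, ?_⟩) h3 <;> linarith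
    · refine ((integrableOn_compl_ball_inv_norm_rpow hs0 one_pos x).const_mul (4 * B)).mono'
        hm.aestronglyMeasurable (Eventually.of_forall fun y => ?_)
      have h1 := abs_le.1 (hψ x)
      have h2 := abs_le.1 (hψ y)
      have h2' := abs_le.1 (hψ (x + x - y))
      have h3 : 0 ≤ ‖x - y‖ ^ ((N : ℝ) + 2 * s) := by positivity
      rw [secondDiff, norm_div, Real.norm_of_nonneg h3, Real.norm_eq_abs, mul_one_div]
      refine div_le_div_of_nonneg_right (abs_le.2 ⟨?_, ?_⟩) h3 <;> linarith

/-- If the second-order difference of `ψ` at `x` is quadratic, the principal values over `B_r(x)`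
exist, and vanish as `r → 0`. In a viscosity inequality the test function thus disappears from the
nonlocal term. -/
theorem exists_hasNonlocal_ball_tendsto_zero [Nontrivial (EuclideanSpace ℝ (Fin N))] {C : ℝ}
    (hs1 : s < 1) (hψc : Continuous ψ)
    (hψ : ∀ y, 2 * ψ x - ψ y - ψ (x + x - y) = C * ‖x - y‖ ^ 2) :
    ∃ a : ℝ → ℝ, (∀ r, HasNonlocal s (Metric.ball x r) ψ x (a r)) ∧
      Tendsto a (𝓝[>] 0) (𝓝 0) := by
  have hint : ∀ r, IntegrableOn (secondDiff s ψ x) (Metric.ball x r) := fun r => by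
    have := (integrableOn_ball_norm_sq_div hs1 x r).const_mul C
    simp only [← mul_div_assoc, ← hψ] at this
    exact this
  refine ⟨fun r => normConst N s * (1 / 2 * ∫ y in Metric.ball x r, secondDiff s ψ x y),
    fun r => ?_, ?_⟩
  · refine hasNonlocal_of_integrableOn_secondDiff ?_ (fun ω hω => ?_) (hint r)
    · ext y
      simp only [mem_preimage, Metric.mem_ball, dist_eq_norm]
      rw [show x + x - y - x = x - y by abel, norm_sub_rev]
    · have hcomp : IsCompact (Metric.closedBall x r \ Metric.ball x ω) :=
        (isCompact_closedBall x r).diff Metric.isOpen_ball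
      refine (ContinuousOn.integrableOn_compact hcomp ?_).mono_set
        (sdiff_subset_sdiff_left Metric.ball_subset_closedBall)
      unfold kernelDiff
      have hne : ∀ y ∈ Metric.closedBall x r \ Metric.ball x ω, 0 < ‖x - y‖ := fun y hy => by
        have : ω ≤ ‖x - y‖ := by simpa [dist_comm, dist_eq_norm] using hy.2
        exact lt_of_lt_of_le hω this
      refine ContinuousOn.div (by fun_prop) ?_ fun y hy => (Real.rpow_pos_of_pos (hne y hy) _).ne'
      exact ContinuousOn.rpow_const (by fun_prop) fun y hy => Or.inl (hne y hy).ne'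
  · have h0 : secondDiff s ψ x x = 0 := by
      rw [secondDiff, add_sub_cancel_right]
      ring
    have h1 := tendsto_setIntegral_diff_ball (hint 1) h0
    have h2 : Tendsto (fun r : ℝ => ∫ y in Metric.ball x r, secondDiff s ψ x y) (𝓝[>] 0)
        (𝓝 0) := by
      have h3 := h1.const_sub (∫ y in Metric.ball x 1, secondDiff s ψ x y)
      rw [sub_self] at h3
      refine h3.congr' ?_
      filter_upwards [Ioo_mem_nhdsGT one_pos] with r hr
      rw [setIntegral_sdiff Metric.isOpen_ball.measurableSet (hint 1)
        (Metric.ball_subset_ball hr.2.le), sub_sub_cancel]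
    have h4 := (h2.const_mul (1 / 2)).const_mul (normConst N s)
    rwa [mul_zero, mul_zero] at h4

theorem setIntegral_kernelDiff_compl_ball (s : ℝ) (ψ : EuclideanSpace ℝ (Fin N) → ℝ)
    (x : EuclideanSpace ℝ (Fin N)) (r : ℝ) :
    ∫ y in (Metric.ball x r)ᶜ, kernelDiff s ψ x y =
      ∫ h in (Metric.ball (0 : EuclideanSpace ℝ (Fin N)) r)ᶜ, kernelDiff s ψ x (x + h) := by
  rw [← (measurePreserving_add_left volume x).setIntegral_preimage_emb
    (measurableEmbedding_addLeft x)]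
  congr 2
  ext y
  simp

theorem integrableOn_kernelDiff_add
    (hint : IntegrableOn (kernelDiff s ψ x) (Metric.ball x r)ᶜ) :
    IntegrableOn (fun h => kernelDiff s ψ x (x + h))
      (Metric.ball (0 : EuclideanSpace ℝ (Fin N)) r)ᶜ := by
  have h1 := ((measurePreserving_add_left volume x).integrableOn_comp_preimage
    (measurableEmbedding_addLeft x)).2 hint
  have h2 : (fun h => x + h) ⁻¹' (Metric.ball x r)ᶜ =
      (Metric.ball (0 : EuclideanSpace ℝ (Fin N)) r)ᶜ := by
    ext y
    simp
  rw [h2] at h1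
  exact h1

/-- Pointwise comparison of increments carries over to the nonlocal terms outside a ball. -/
theorem sum_setIntegral_kernelDiff_le {ι : Type} [Fintype ι] {μ : ι → ℝ}
    {ξ : ι → EuclideanSpace ℝ (Fin N)} {f : ι → EuclideanSpace ℝ (Fin N) → ℝ}
    (h : ∀ h, ψ (x + h) - ψ x ≤ ∑ i, μ i * (f i (ξ i + h) - f i (ξ i)))
    (hψ : IntegrableOn (kernelDiff s ψ x) (Metric.ball x r)ᶜ)
    (hf : ∀ i, IntegrableOn (kernelDiff s (f i) (ξ i)) (Metric.ball (ξ i) r)ᶜ) :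
    ∑ i, μ i * ∫ y in (Metric.ball (ξ i) r)ᶜ, kernelDiff s (f i) (ξ i) y ≤
      ∫ y in (Metric.ball x r)ᶜ, kernelDiff s ψ x y := by
  simp only [setIntegral_kernelDiff_compl_ball, ← integral_const_mul]
  have hf' : ∀ i, Integrable (fun h => μ i * kernelDiff s (f i) (ξ i) (ξ i + h))
      (volume.restrict (Metric.ball (0 : EuclideanSpace ℝ (Fin N)) r)ᶜ) := fun i =>
    (integrableOn_kernelDiff_add (hf i)).const_mul (μ i)
  rw [← integral_finsetSum _ fun i _ => hf' i]
  refine integral_mono (integrable_finsetSum _ fun i _ => hf' i)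
    (integrableOn_kernelDiff_add hψ) fun y => ?_
  have h1 : ∀ i, μ i * kernelDiff s (f i) (ξ i) (ξ i + y) =
      μ i * (f i (ξ i) - f i (ξ i + y)) / ‖y‖ ^ ((N : ℝ) + 2 * s) := fun i => by
    rw [kernelDiff, mul_div_assoc, sub_add_cancel_left, norm_neg]
  simp only [h1, ← Finset.sum_div]
  rw [kernelDiff, sub_add_cancel_left, norm_neg]
  refine div_le_div_of_nonneg_right ?_ (by positivity)
  have h2 : ∑ i, μ i * (f i (ξ i) - f i (ξ i + y)) =
      -∑ i, μ i * (f i (ξ i + y) - f i (ξ i)) := by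
    rw [← Finset.sum_neg_distrib]
    exact Finset.sum_congr rfl fun i _ => by ring
  linarith [h y]

end nonlocal

/-! ### The lower extension -/

section lowerExt

variable {N : ℕ} {Ω : Set (EuclideanSpace ℝ (Fin N))} {T M : ℝ}
  {u : EuclideanSpace ℝ (Fin N) → ℝ → ℝ}

theorem abs_lowerExt_le (hM : 0 ≤ M) (hub : ∀ x ∈ closure Ω, ∀ t ∈ Icc 0 T, |u x t| ≤ M)
    (x : EuclideanSpace ℝ (Fin N)) {t : ℝ} (ht : t ∈ Icc 0 T) : |lowerExt Ω u x t| ≤ M := by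
  unfold lowerExt
  split_ifs with h1 h2
  · exact hub x (subset_closure h1) t ht
  · have := abs_le.1 (hub x (frontier_subset_closure h2) t ht)
    exact abs_le.2 ⟨le_min this.1 (by linarith), (min_le_right _ _).trans hM⟩
  · simpa

theorem lowerSemicontinuousOn_lowerExt (hΩ : IsOpen Ω)
    (hlsc : LowerSemicontinuousOn
      (fun z : EuclideanSpace ℝ (Fin N) × ℝ => u z.1 z.2) (closure Ω ×ˢ Icc 0 T)) :
    LowerSemicontinuousOn (fun z : EuclideanSpace ℝ (Fin N) × ℝ => lowerExt Ω u z.1 z.2)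
      (univ ×ˢ Icc 0 T) := by
  rintro ⟨x, t⟩ ⟨-, ht⟩ a ha
  dsimp only at ha ht
  by_cases hcl : x ∈ closure Ω
  · have hau : a < u x t := by
      unfold lowerExt at ha
      split_ifs at ha with h1 h2
      · exact ha
      · exact ha.trans_le (min_le_left _ _)
      · exact (h2 (hΩ.frontier_eq ▸ ⟨hcl, h1⟩)).elim
    have hev := hlsc (x, t) ⟨hcl, ht⟩ a hau
    rw [eventually_nhdsWithin_iff] at hev
    -- Points near `x` lie in `Ω` when `x ∈ Ω`; otherwise `x ∈ ∂Ω`, and `a < 0`.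
    have hside : ∀ᶠ z in 𝓝 (x, t), z.1 ∈ Ω ∨ a < 0 := by
      by_cases hx : x ∈ Ω
      · filter_upwards [(hΩ.preimage continuous_fst).mem_nhds
          (show (x, t) ∈ Prod.fst ⁻¹' Ω from hx)] with z hz
        exact Or.inl hz
      · have hfr : x ∈ frontier Ω := hΩ.frontier_eq ▸ ⟨hcl, hx⟩
        rw [lowerExt, if_neg hx, if_pos hfr] at ha
        exact Eventually.of_forall fun _ => Or.inr (ha.trans_le (min_le_right _ _))
    rw [eventually_nhdsWithin_iff]
    filter_upwards [hev, hside] with z hz hz' hzT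
    unfold lowerExt
    split_ifs with h1 h2
    · exact hz ⟨subset_closure h1, hzT.2⟩
    · exact lt_min (hz ⟨frontier_subset_closure h2, hzT.2⟩) (hz'.resolve_left h1)
    · exact hz'.resolve_left h1
  · refine Filter.Eventually.filter_mono nhdsWithin_le_nhds ?_
    have hval : ∀ z : EuclideanSpace ℝ (Fin N), z ∉ closure Ω → ∀ τ, lowerExt Ω u z τ = 0 :=
      fun z hz τ => by
        rw [lowerExt, if_neg fun h => hz (subset_closure h),
          if_neg fun h => hz (frontier_subset_closure h)]
    rw [hval x hcl] at ha
    filter_upwards [(isClosed_closure.isOpen_compl.preimage continuous_fst).mem_nhds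
      (show (x, t) ∈ Prod.fst ⁻¹' (closure Ω)ᶜ from hcl)] with z hz
    rwa [hval z.1 hz]

theorem IsBddLsc.measurable {v : EuclideanSpace ℝ (Fin N) → ℝ → ℝ} (hv : IsBddLsc T M v) {τ : ℝ}
    (hτ : τ ∈ Icc 0 T) : Measurable fun y => v y τ := by
  refine LowerSemicontinuous.measurable fun y a ha => ?_
  have h1 : Tendsto (fun y' : EuclideanSpace ℝ (Fin N) => (y', τ)) (𝓝 y)
      (𝓝[univ ×ˢ Icc 0 T] (y, τ)) :=
    tendsto_nhdsWithin_iff.2 ⟨(by fun_prop : Continuous _).tendsto y,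
      Eventually.of_forall fun _ => ⟨mem_univ _, hτ⟩⟩
  exact h1.eventually (hv.lsc (y, τ) ⟨mem_univ _, hτ⟩ a ha)

/-- A point closer to `x ∈ Ω` than the boundary of `Ω` lies in `Ω`, since the segment between them
does not cross the boundary. -/
theorem mem_of_dist_lt_infDist_frontier {E : Type*} [NormedAddCommGroup E] [NormedSpace ℝ E]
    {Ω : Set E} {x z : E} (hx : x ∈ Ω) (h : dist x z < Metric.infDist x (frontier Ω)) :
    z ∈ Ω := by
  by_contra hz
  have hdisj : ∀ b ∈ segment ℝ x z, b ∉ frontier Ω := fun b hb hbf => by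
    have h1 := Metric.infDist_le_dist_of_mem (x := x) hbf
    have h2 := dist_add_dist_of_mem_segment hb
    linarith [dist_nonneg (x := b) (y := z)]
  have hx' := hdisj x (left_mem_segment ℝ x z)
  have hz' := hdisj z (right_mem_segment ℝ x z)
  rw [frontier, Set.mem_sdiff, not_and_not_right] at hx' hz'
  have hcover : segment ℝ x z ⊆ interior Ω ∪ (closure Ω)ᶜ := fun b hb => by
    have := hdisj b hb
    rw [frontier, Set.mem_sdiff, not_and_not_right] at this
    by_cases h : b ∈ closure Ω
    · exact Or.inl (this h)
    · exact Or.inr h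
  obtain ⟨b, -, hb1, hb2⟩ := (convex_segment x z).isPreconnected (interior Ω) (closure Ω)ᶜ
    isOpen_interior isClosed_closure.isOpen_compl hcover
    ⟨x, left_mem_segment ℝ x z, hx' (subset_closure hx)⟩
    ⟨z, right_mem_segment ℝ x z, fun h => hz (interior_subset (hz' h))⟩
  exact hb2 (interior_subset_closure hb1)

end lowerExt

/-! ### Lipschitz regularity and differentiability in time -/

section regularity

variable {N : ℕ} {T M δ κ c t t' : ℝ} {v : EuclideanSpace ℝ (Fin N) → ℝ → ℝ}

theorem supConv_infConv_le_add_time (hv : IsBddLsc T M v) (hc : 0 < c) (hδ : 0 < δ)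
    (hκ : 0 < κ) (ht : t ∈ Ioo 0 T) (ht' : t' ∈ Ioo 0 T) (x : EuclideanSpace ℝ (Fin N)) :
    supConv δ (infConv T c κ v) x t ≤ supConv δ (infConv T c κ v) x t' + T / κ * |t - t'| := by
  refine supConv_le fun y => ?_
  have h1 := le_supConv (x := x) (fun y => abs_infConv_le (x := y) hv hc hκ ht') hδ y
  have h2 := infConv_le_add_time (x := y) hv hc hκ ht ht'
  linarith

theorem supConv_le_add_norm {f : EuclideanSpace ℝ (Fin N) → ℝ → ℝ} (hM : 0 ≤ M)
    (hf : ∀ y, |f y t| ≤ M) (hδ : 0 < δ) (husc : UpperSemicontinuous fun y => f y t)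
    (x x' : EuclideanSpace ℝ (Fin N)) :
    supConv δ f x t ≤ supConv δ f x' t + 3 * √(4 * M * δ) / (2 * δ) * ‖x - x'‖ := by
  set R := √(4 * M * δ) with hR
  have hR0 : 0 ≤ R := Real.sqrt_nonneg _
  have hR2 : R ^ 2 = 4 * M * δ := Real.sq_sqrt (by positivity)
  set d := ‖x - x'‖ with hd
  have hd0 : 0 ≤ d := norm_nonneg _
  -- For `|x - x'| > R` the bound `2M` on the oscillation is enough, as `R² = 4Mδ`.
  have key : (supConv δ f x t - supConv δ f x' t) * (2 * δ) ≤ 3 * R * d := by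
    rcases le_or_gt d R with hdR | hdR
    · obtain ⟨y, hy⟩ := exists_supConv_eq hf hδ husc x
      have h1 := le_supConv (x := x') hf hδ y
      have h2 : ‖x - y‖ ≤ R := Real.le_sqrt_of_sq_le
        (norm_sq_le_of_le_quad hf hδ (hy ▸ le_supConv_self hf hδ))
      have h3 : ‖x' - y‖ ≤ ‖x - y‖ + d := by
        have := norm_add_le (x - y) (x' - x)
        rwa [show x - y + (x' - x) = x' - y by abel, norm_sub_rev x' x] at this
      have h4 : ‖x' - y‖ ^ 2 ≤ (‖x - y‖ + d) ^ 2 := by gcongr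
      have h5 : supConv δ f x t - supConv δ f x' t ≤
          1 / (2 * δ) * (‖x' - y‖ ^ 2 - ‖x - y‖ ^ 2) := by linarith
      have h6 : (supConv δ f x t - supConv δ f x' t) * (2 * δ) ≤ ‖x' - y‖ ^ 2 - ‖x - y‖ ^ 2 := by
        refine (mul_le_mul_of_nonneg_right h5 (by positivity)).trans (le_of_eq ?_)
        field_simp
      nlinarith [mul_le_mul_of_nonneg_right h2 hd0, mul_le_mul_of_nonneg_right hdR hd0]
    · have h1 := abs_le.1 (abs_supConv_le (x := x) hf hδ)
      have h2 := abs_le.1 (abs_supConv_le (x := x') hf hδ)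
      have h3 : (supConv δ f x t - supConv δ f x' t) * (2 * δ) ≤ 2 * M * (2 * δ) :=
        mul_le_mul_of_nonneg_right (by linarith) (by positivity)
      nlinarith [mul_le_mul_of_nonneg_left hdR.le hR0, mul_nonneg hR0 hd0]
  rw [← sub_le_iff_le_add', div_mul_eq_mul_div, le_div_iff₀ (by positivity)]
  exact key

theorem lipschitzOnWith_supConv_infConv (hM : 0 ≤ M) (hv : IsBddLsc T M v) (hc : 0 < c)
    (hδ : 0 < δ) (hκ : 0 < κ) :
    ∃ K, LipschitzOnWith K (fun z : EuclideanSpace ℝ (Fin N) × ℝ =>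
      supConv δ (infConv T c κ v) z.1 z.2) (univ ×ˢ Ioo 0 T) := by
  set C := 3 * √(4 * M * δ) / (2 * δ) with hC
  have hC0 : 0 ≤ C := by positivity
  refine ⟨Real.toNNReal (C + T / κ), LipschitzOnWith.of_dist_le_mul ?_⟩
  have key : ∀ z ∈ (univ ×ˢ Ioo 0 T : Set (EuclideanSpace ℝ (Fin N) × ℝ)),
      ∀ z' ∈ (univ ×ˢ Ioo 0 T : Set (EuclideanSpace ℝ (Fin N) × ℝ)),
      supConv δ (infConv T c κ v) z.1 z.2 - supConv δ (infConv T c κ v) z'.1 z'.2 ≤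
        (C + T / κ) * dist z z' := by
    rintro z ⟨-, hz⟩ z' ⟨-, hz'⟩
    have hT : 0 ≤ T / κ := div_nonneg (hz.1.trans hz.2).le hκ.le
    have h1 := supConv_infConv_le_add_time hv hc hδ hκ hz hz' z.1
    have h2 := supConv_le_add_norm hM (fun y => abs_infConv_le (x := y) hv hc hκ hz') hδ
      (upperSemicontinuous_infConv hv hc hκ) z.1 z'.1
    have h3 : ‖z.1 - z'.1‖ ≤ dist z z' := by
      rw [← dist_eq_norm]; exact le_max_left _ _
    have h4 : |z.2 - z'.2| ≤ dist z z' := by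
      rw [← Real.dist_eq]; exact le_max_right _ _
    have h5 := mul_le_mul_of_nonneg_left h3 hC0
    have h6 := mul_le_mul_of_nonneg_left h4 hT
    linarith
  intro z hz z' hz'
  have hT : 0 ≤ T / κ := div_nonneg (hz.2.1.trans hz.2.2).le hκ.le
  rw [Real.coe_toNNReal _ (by positivity), Real.dist_eq]
  have h1 := key z hz z' hz'
  have h2 := key z' hz' z hz
  rw [dist_comm z' z] at h2
  exact abs_le.2 ⟨by linarith, h1⟩

/-- Rademacher's theorem, for the partial derivative in time. -/
theorem ae_differentiableAt_of_lipschitzOnWith {f : EuclideanSpace ℝ (Fin N) → ℝ → ℝ}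
    {K : NNReal} {I : Set ℝ} (hI : IsOpen I)
    (hf : LipschitzOnWith K (fun z : EuclideanSpace ℝ (Fin N) × ℝ => f z.1 z.2) (univ ×ˢ I)) :
    ∀ᵐ z : EuclideanSpace ℝ (Fin N) × ℝ ∂(volume.restrict (univ ×ˢ I)),
      DifferentiableAt ℝ (fun τ => f z.1 τ) z.2 := by
  have : (volume : Measure (EuclideanSpace ℝ (Fin N) × ℝ)).IsAddHaarMeasure := by
    rw [Measure.volume_eq_prod]
    infer_instance
  have hopen : IsOpen (univ ×ˢ I : Set (EuclideanSpace ℝ (Fin N) × ℝ)) := isOpen_univ.prod hI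
  filter_upwards [hf.ae_differentiableWithinAt (μ := volume) hopen.measurableSet,
    ae_restrict_mem hopen.measurableSet] with z hz hzI
  have h1 := hz.differentiableAt (hopen.mem_nhds hzI)
  have h2 : DifferentiableAt ℝ (fun τ : ℝ => (z.1, τ)) z.2 := by fun_prop
  exact DifferentiableAt.comp
    (g := fun z : EuclideanSpace ℝ (Fin N) × ℝ => f z.1 z.2) z.2 h1 h2

end regularity

/-! ### The supersolution inequality -/

section supersolution

variable {N : ℕ} {s p T M c κ t : ℝ} {Ω : Set (EuclideanSpace ℝ (Fin N))}
  {u : EuclideanSpace ℝ (Fin N) → ℝ → ℝ} {y : EuclideanSpace ℝ (Fin N)}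
  {z : EuclideanSpace ℝ (Fin N) × ℝ}

/-- At a minimizer `z` of the inf-convolution at `(y,t)` the paraboloid centred at `(y,t)` touches
the extension of `u` from below, so it is a test function. The viscosity inequality then holds at
`z` with the extension alone in the nonlocal term, up to an error that vanishes with the radius. -/
theorem IsSupersolution.exists_tendsto_of_mem_infArgmin
    [Nontrivial (EuclideanSpace ℝ (Fin N))] (hu : IsSupersolution s p Ω T u) (hs0 : 0 < s)
    (hs1 : s < 1) (hv : IsBddLsc T M (lowerExt Ω u)) (hc : 0 < c) (hκ : 0 < κ)
    (hz : z ∈ infArgmin T c κ (lowerExt Ω u) y t) (hzΩ : z.1 ∈ Ω) :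
    ∃ a : ℝ → ℝ, Tendsto a (𝓝[>] 0) (𝓝 0) ∧ ∀ᶠ r in 𝓝[>] 0,
      0 ≤ 1 / κ * (t - z.2) + a r +
        normConst N s * (∫ x in (Metric.ball z.1 r)ᶜ,
          kernelDiff s (fun x => lowerExt Ω u x z.2) z.1 x) -
        ‖(1 / c) • (y - z.1)‖ ^ p := by
  set φ : EuclideanSpace ℝ (Fin N) → ℝ → ℝ := fun x τ =>
    -(1 / (2 * c) * ‖y - x‖ ^ 2) - 1 / (2 * κ) * (t - τ) ^ 2 with hφ
  have hsecond : ∀ x, 2 * φ z.1 z.2 - φ x z.2 - φ (z.1 + z.1 - x) z.2 =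
      1 / c * ‖z.1 - x‖ ^ 2 := by
    intro x
    simp only [hφ]
    have h1 := norm_add_sq_real (y - z.1) (z.1 - x)
    have h2 := norm_sub_sq_real (y - z.1) (z.1 - x)
    rw [sub_add_sub_cancel] at h1
    rw [show y - z.1 - (z.1 - x) = y - (z.1 + z.1 - x) by abel] at h2
    rw [h1, h2]
    field_simp
    ring
  have hcont : Continuous fun x => φ x z.2 := by simp only [hφ]; fun_prop
  obtain ⟨a, ha, ha0⟩ := exists_hasNonlocal_ball_tendsto_zero hs1 hcont hsecond
  refine ⟨a, ha0, ?_⟩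
  set d := min z.2 (T - z.2) with hd
  have hd0 : 0 < d := lt_min hz.1.1 (by linarith [hz.1.2])
  have hd1 : 0 ≤ z.2 - d := by linarith [min_le_left z.2 (T - z.2)]
  have hd2 : z.2 + d ≤ T := by linarith [min_le_right z.2 (T - z.2)]
  have hφ2 : ContDiff ℝ 2 fun w : EuclideanSpace ℝ (Fin N) × ℝ => φ w.1 w.2 := by
    simp only [hφ]
    refine ContDiff.sub (ContDiff.neg (contDiff_const.mul ?_)) (by fun_prop)
    exact (contDiff_const.sub contDiff_fst).norm_sq ℝ
  have hder : deriv (fun τ => φ z.1 τ) z.2 = 1 / κ * (t - z.2) := by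
    have h1 := ((((hasDerivAt_id z.2).const_sub t).pow 2).const_mul (1 / (2 * κ))).const_sub
      (-(1 / (2 * c) * ‖y - z.1‖ ^ 2))
    refine HasDerivAt.deriv (h1.congr_deriv ?_)
    simp only [id, Nat.cast_ofNat, Nat.add_one_sub_one, pow_one]
    field_simp
  have hgrad : gradient (fun x => φ x z.2) z.1 = (1 / c) • (y - z.1) := by
    refine HasGradientAt.gradient ?_
    rw [hasGradientAt_iff_hasFDerivAt]
    have h1 := (((((hasFDerivAt_id z.1).const_sub y).norm_sq).const_mul
      (1 / (2 * c))).neg).sub_const (1 / (2 * κ) * (t - z.2) ^ 2)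
    refine h1.congr_fderiv ?_
    ext b
    simp [InnerProductSpace.toDual_apply_apply]
    field_simp
    ring
  filter_upwards [Ioo_mem_nhdsGT hd0] with r hr
  have hint := integrableOn_kernelDiff_compl_ball hs0 (hv.measurable (Ioo_subset_Icc_self hz.1))
    (fun x => hv.bound x z.2 (Ioo_subset_Icc_self hz.1)) z.1 hr.1
  have := hu z.1 hzΩ z.2 d hd0 hd1 hd2 φ hφ2.contDiffOn ?_ r hr.1 hr.2 (a r) _ (ha r)
    (hasNonlocal_compl_ball hr.1 hint)
  · rwa [hder, hgrad] at this
  · intro x _ τ hτ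
    have := hz.2 (x, τ) ⟨by linarith [hτ.1], by linarith [hτ.2]⟩
    simp only [infCost, sq_abs] at this
    simp only [hφ]
    linarith

/-- Jensen's inequality for `|·|^p`. -/
theorem norm_sum_smul_rpow_le {E ι : Type*} [SeminormedAddCommGroup E] [NormedSpace ℝ E]
    [Fintype ι] {μ : ι → ℝ} (hμ : ∀ i, 0 ≤ μ i) (hμ1 : ∑ i, μ i = 1) (hp : 1 ≤ p) (g : ι → E) :
    ‖∑ i, μ i • g i‖ ^ p ≤ ∑ i, μ i * ‖g i‖ ^ p := by
  have h1 : ‖∑ i, μ i • g i‖ ≤ ∑ i, μ i • ‖g i‖ := by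
    refine (norm_sum_le _ _).trans (le_of_eq (Finset.sum_congr rfl fun i _ => ?_))
    rw [norm_smul, Real.norm_of_nonneg (hμ i), smul_eq_mul]
  refine (Real.rpow_le_rpow (norm_nonneg _) h1 (by linarith)).trans ?_
  exact (convexOn_rpow hp).map_sum_le (fun i _ => hμ i) hμ1 fun i _ => norm_nonneg (g i)

/-- In dimension `0` the boundary is empty and the distance to it has the junk value `0`, so
`innerSet` is empty. -/
theorem innerSet_eq_empty [Subsingleton (EuclideanSpace ℝ (Fin N))] {η : ℝ} (hη : 0 < η) :
    innerSet Ω η = ∅ := by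
  refine eq_empty_of_forall_notMem fun x hx => ?_
  have h1 : Ω = univ := Subsingleton.eq_univ_of_nonempty ⟨x, hx.1⟩
  have h2 := hx.2
  rw [h1, frontier_univ, Metric.infDist_empty] at h2
  linarith

theorem isOpen_innerSet (hΩ : IsOpen Ω) (η : ℝ) : IsOpen (innerSet Ω η) :=
  hΩ.inter (isOpen_lt continuous_const (Metric.continuous_infDist_pt _))

/-- The averaged viscosity inequalities at the base points give the pointwise inequality for `w`:
the time derivative is the average of theirs, the nonlocal term is at least the average, and by
convexity the gradient term is at most the average. -/
theorem IsDecomposition.add_sub_rpow_nonneg [Nontrivial (EuclideanSpace ℝ (Fin N))]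
    {ι : Type} [Fintype ι] {μ : ι → ℝ} {z : ι → EuclideanSpace ℝ (Fin N) × ℝ} {ε δ : ℝ}
    {x : EuclideanSpace ℝ (Fin N)}
    (hd : IsDecomposition T (ε + δ) δ κ (lowerExt Ω u) x t y μ z)
    (hu : IsSupersolution s p Ω T u) (hs0 : 0 < s) (hs1 : s < 1) (hp : 1 ≤ p)
    (hv : IsBddLsc T M (lowerExt Ω u)) (hε : 0 < ε) (hδ : 0 < δ) (hκ : 0 < κ)
    (ht : t ∈ Ioo 0 T) (hzΩ : ∀ i, (z i).1 ∈ Ω)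
    (hm : Measurable fun x' => infSupConv Ω T ε δ κ u x' t) {a L : ℝ}
    (ha : HasDerivAt (fun τ => infSupConv Ω T ε δ κ u x τ) a t)
    (hL : HasFracLaplacian s (fun x' => infSupConv Ω T ε δ κ u x' t) x L) :
    0 ≤ a + L - ‖(1 / δ) • (y - x)‖ ^ p := by
  have hc : 0 < ε + δ := by positivity
  choose b hb0 hb using fun i => hu.exists_tendsto_of_mem_infArgmin hs0 hs1 hv hc hκ
    (hd.mem i) (hzΩ i)
  set W := fun x' => infSupConv Ω T ε δ κ u x' t with hW
  have hWb : ∀ x', |W x'| ≤ M := fun x' =>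
    abs_supConv_le (fun y => abs_infConv_le hv hc hκ ht) hδ
  have hlim : Tendsto (fun r => a + ∑ i, μ i * b i r +
      normConst N s * (∫ x' in univ \ Metric.ball x r, kernelDiff s W x x') -
      ‖(1 / δ) • (y - x)‖ ^ p) (𝓝[>] 0) (𝓝 (a + L - ‖(1 / δ) • (y - x)‖ ^ p)) := by
    have h1 : Tendsto (fun r => ∑ i, μ i * b i r) (𝓝[>] 0) (𝓝 (∑ i, μ i * 0)) :=
      tendsto_finsetSum _ fun i _ => (hb0 i).const_mul (μ i)
    simp only [mul_zero, Finset.sum_const_zero] at h1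
    have h2 := ((h1.const_add a).add hL.2).sub_const (‖(1 / δ) • (y - x)‖ ^ p)
    rwa [add_zero] at h2
  refine ge_of_tendsto hlim ?_
  filter_upwards [eventually_all.2 hb, self_mem_nhdsWithin] with r hr hr0
  have hcmp := sum_setIntegral_kernelDiff_le (s := s) (r := r) (x := x) (ψ := W)
    (f := fun i x' => lowerExt Ω u x' (z i).2) (ξ := fun i => (z i).1)
    (hd.supConv_sub_le hv hε hδ hκ)
    (integrableOn_kernelDiff_compl_ball hs0 hm hWb x hr0)
    fun i => integrableOn_kernelDiff_compl_ball hs0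
      (hv.measurable (Ioo_subset_Icc_self (hd.mem i).1))
      (fun x' => hv.bound x' _ (Ioo_subset_Icc_self (hd.mem i).1)) _ hr0
  have hcmp' := mul_le_mul_of_nonneg_left hcmp (normConst_nonneg N hs0 hs1)
  have hjensen := norm_sum_smul_rpow_le hd.nonneg hd.sum_eq_one hp
    fun i => (1 / (ε + δ)) • (y - (z i).1)
  rw [hd.sum_smul] at hjensen
  have hsum := Finset.sum_nonneg fun i (_ : i ∈ Finset.univ) =>
    mul_nonneg (hd.nonneg i) (hr i)
  simp only [mul_add, mul_sub, Finset.sum_add_distrib, Finset.sum_sub_distrib] at hsum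
  have htime := hd.eq_of_hasDerivAt hv hε hδ hκ ha
  simp only [mul_sub, Finset.sum_sub_distrib] at htime
  rw [Finset.mul_sum] at hcmp'
  simp only [mul_left_comm (normConst N s)] at hcmp'
  rw [← compl_eq_univ_sdiff]
  linarith

end supersolution

end FracHJ

theorem mainTheorem7 {N : ℕ} (s p : ℝ) (hs0 : 0 < s) (hs1 : s < 1)
    (hp0 : s + 1 < p) (hp1 : p < s / (1 - s))
    (Ω : Set (EuclideanSpace ℝ (Fin N))) (hΩo : IsOpen Ω) (hΩb : Bornology.IsBounded Ω)
    (T η t₀ t₁ : ℝ) (hη : 0 < η) (ht₀ : 0 < t₀) (ht₀₁ : t₀ < t₁) (ht₁ : t₁ < T)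
    (u : EuclideanSpace ℝ (Fin N) → ℝ → ℝ)
    (hub : ∃ M : ℝ, ∀ x ∈ closure Ω, ∀ t ∈ Set.Icc 0 T, |u x t| ≤ M)
    (hlsc : LowerSemicontinuousOn
      (fun z : EuclideanSpace ℝ (Fin N) × ℝ => u z.1 z.2) (closure Ω ×ˢ Set.Icc 0 T))
    (hu : FracHJ.IsSupersolution s p Ω T u) :
    ∃ ε δ κ : ℝ, 0 < ε ∧ 0 < δ ∧ 0 < κ ∧
      ∀ᵐ z : EuclideanSpace ℝ (Fin N) × ℝ
          ∂(MeasureTheory.volume.restrict (FracHJ.innerSet Ω η ×ˢ Set.Ioo t₀ t₁)),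
        ∃ (a L : ℝ) (q : EuclideanSpace ℝ (Fin N)),
          HasDerivAt (fun τ => FracHJ.infSupConv Ω T ε δ κ u z.1 τ) a z.2 ∧
          HasGradientAt (fun y => FracHJ.infSupConv Ω T ε δ κ u y z.2) q z.1 ∧
          FracHJ.HasFracLaplacian s (fun y => FracHJ.infSupConv Ω T ε δ κ u y z.2) z.1 L ∧
          0 ≤ a + L - ‖q‖ ^ p := by
  open FracHJ in
  rcases subsingleton_or_nontrivial (EuclideanSpace ℝ (Fin N)) with hN | hN
  · refine ⟨1, 1, 1, one_pos, one_pos, one_pos, ?_⟩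
    rw [innerSet_eq_empty hη, Set.empty_prod, Measure.restrict_empty]
    simp
  obtain ⟨M₀, hM₀⟩ := hub
  set M := max M₀ 1 with hM
  have hM1 : 0 < M := one_pos.trans_le (le_max_right _ _)
  have hv : IsBddLsc T M (lowerExt Ω u) :=
    ⟨fun x τ hτ => abs_lowerExt_le hM1.le
      (fun x hx t ht => (hM₀ x hx t ht).trans (le_max_left _ _)) x hτ,
      lowerSemicontinuousOn_lowerExt hΩo hlsc⟩
  -- `δ` keeps the base points within `η` of `x`; `κ` keeps their times within `ρ` of `t`.
  set δ := η ^ 2 / (64 * M) with hδ_def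
  set ρ := min t₀ (T - t₁) with hρ_def
  set κ := ρ ^ 2 / (4 * M) with hκ_def
  have hδ : 0 < δ := by positivity
  have hρ : 0 < ρ := lt_min ht₀ (by linarith)
  have hκ : 0 < κ := by positivity
  have hc : 0 < δ + δ := by positivity
  have hMκ : 4 * M * κ ≤ ρ ^ 2 := le_of_eq (by rw [hκ_def]; field_simp)
  have hMδ : M * δ = η ^ 2 / 64 := by rw [hδ_def]; field_simp
  refine ⟨δ, δ, κ, hδ, hδ, hκ, ?_⟩
  obtain ⟨K, hK⟩ := lipschitzOnWith_supConv_infConv hM1.le hv hc hδ hκ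
  have hsub : innerSet Ω η ×ˢ Ioo t₀ t₁ ⊆
      (univ ×ˢ Ioo 0 T : Set (EuclideanSpace ℝ (Fin N) × ℝ)) :=
    Set.prod_mono (subset_univ _) (Ioo_subset_Ioo ht₀.le ht₁.le)
  have hdiff := ae_restrict_of_ae_restrict_of_subset hsub
    (ae_differentiableAt_of_lipschitzOnWith isOpen_Ioo hK)
  have hmem := ae_restrict_mem (μ := (volume : Measure (EuclideanSpace ℝ (Fin N) × ℝ)))
    ((isOpen_innerSet hΩo η).prod (isOpen_Ioo (a := t₀) (b := t₁))).measurableSet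
  filter_upwards [hdiff, hmem] with ⟨x, t⟩ hd' ⟨hx, ht⟩
  dsimp only at hx ht hd'
  have htT : t ∈ Ioo 0 T := ⟨ht₀.trans ht.1, ht.2.trans ht₁⟩
  have hρt : ρ < t := (min_le_left _ _).trans_lt ht.1
  have hρT : t + ρ < T := by linarith [min_le_right t₀ (T - t₁), ht.2]
  have hgrad : ∀ x', ∃ q,
      HasGradientAt (fun y => infSupConv Ω T δ δ κ u y t) q x' := fun x' => by
    obtain ⟨y, ι, _, μ, z, h⟩ := exists_isDecomposition hv hc hδ hκ hρ.le hρt hρT hMκ x'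
    exact ⟨_, h.hasGradientAt hv hδ hδ hκ htT⟩
  have hmeas : Measurable fun x' => infSupConv Ω T δ δ κ u x' t :=
    (continuous_iff_continuousAt.2 fun x' =>
      (hgrad x').choose_spec.continuousAt).measurable
  obtain ⟨y, ι, _, μ, z, h⟩ := exists_isDecomposition hv hc hδ hκ hρ.le hρt hρT hMκ x
  obtain ⟨L, hL⟩ := exists_hasFracLaplacian hs0 hs1 hmeas
    (fun x' => abs_supConv_le (fun y => abs_infConv_le (x := y) hv hc hκ htT) hδ)
    (h.abs_supConv_sub_inner_le hv hδ hδ hκ htT)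
  -- The base points stay within `η` of `x`: `|x - y| ≤ η / 4` and `|y - zᵢ| ≤ η / 2`.
  have hzΩ : ∀ i, (z i).1 ∈ Ω := fun i => by
    refine mem_of_dist_lt_infDist_frontier hx.1 (lt_of_le_of_lt ?_ hx.2)
    have hf : ∀ y, |infConv T (δ + δ) κ (lowerExt Ω u) y t| ≤ M := fun y =>
      abs_infConv_le hv hc hκ htT
    have h1 : ‖x - y‖ ^ 2 ≤ 4 * M * δ :=
      norm_sq_le_of_le_quad hf hδ (h.supConv_eq ▸ le_supConv_self hf hδ)
    have h2 := (quad_le_of_mem_infArgmin hv hc hκ htT (h.mem i)).1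
    have h3 : ‖x - y‖ ≤ η / 4 := le_of_sq_le_sq (by nlinarith) (by positivity)
    have h4 : ‖y - (z i).1‖ ≤ η / 2 := le_of_sq_le_sq (by nlinarith) (by positivity)
    have h5 := dist_triangle x y (z i).1
    rw [dist_eq_norm x y, dist_eq_norm y] at h5
    linarith
  exact ⟨_, L, _, hd'.hasDerivAt, h.hasGradientAt hv hδ hδ hκ htT, hL,
    h.add_sub_rpow_nonneg hu hs0 hs1 (by linarith) hv hδ hδ hκ htT hzΩ hmeas hd'.hasDerivAt hL⟩
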